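/- Let $g,h\ge 1$ be integers and let $G=H_{\mathbb R}^{(g,h)}$ be the Heisenberg group of all triples $(\lambda,\mu,\kappa)$ with $\lambda,\mu\in\mathbb R^{(h,g)}$ (real $h\times g$ matrices), $\kappa\in\mathbb R^{(h,h)}$ and $\kappa+\mu\,{}^t\!\lambda$ symmetric, with multiplication $$(\lambda,\mu,\kappa)\circ(\lambda',\mu',\kappa')=(\lambda+\lambda',\,\mu+\mu',\,\kappa+\kappa'+\lambda\,{}^t\!\mu'-\mu\,{}^t\!\lambda').$$ Write $[\lambda,\mu,\kappa]:=(0,\mu,\kappa)\circ(\lambda,0,0)=(\lambda,\mu,\kappa-\mu\,{}^t\!\lambda)$ for $\kappa$ symmetric. Let $L=\mathbb Z^{(h,g)}\times\mathbb Z^{(h,g)}$, $\Gamma_L=\{(\lambda,\mu,\kappa)\in G:(\lambda,\mu)\in L\}$ and $K=\{(0,\mu,\kappa)\in G\}$; both are closed normal subgroups of $G$. For a closed normal subgroup $N$ of $G$ and a unitary character $\chi$ of $N$, let $\mathrm{Ind}_N^G\chi$ be the action of $G$ by right translation, $(\pi(g_0)\phi)(x)=\phi(xg_0)$, on the Hilbert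 space of measurable $\phi:G\to\mathbb C$ with $\phi(nx)=\chi(n)\phi(x)$ for all $n\in N$, $x\in G$, and $\int_{N\backslash G}|\phi|^2<\infty$ with respect to an invariant (Haar) measure on $N\backslash G$, modulo functions of norm zero. **Theorem.** Let $M$ be a positive definite symmetric half-integral $h\times h$ matrix (that is, $M_{ii}\in\mathbb Z$ and $2M_{ij}\in\mathbb Z$ for all $i,j$), let $\sigma_M$ be the character $(0,\mu,\kappa)\mapsto e^{2\pi i\,\mathrm{tr}(M\kappa)}$ of $K$, and let $\varphi_M$ be the character of $\Gamma_L$ given by $$\varphi_M([\lambda,\mu,\kappa])=e^{2\pi i\,\mathrm{tr}(M\kappa)},\qquad\text{i.e. } \varphi_M((\lambda,\mu,\kappa))=e^{2\pi i\,\mathrm{tr}(M(\kappa+\mu\,{}^t\!\lambda))}.$$ Then, for any choice of the invariant measures, the lattice representation $\pi_M=\mathrm{Ind}_{\Gamma_L}^G\varphi_M$ is unitarily equivalent to the direct sum of $(\det 2M)^g$ copies (this number is a natural number) of the Schrödinger representation $\mathrm{Ind}_K^G\sigma_M$. The same holds with $\varphi_M$ replaced by $(\lambda,\mu,\kappa)\mapsto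 e^{2\pi i\,\mathrm{tr}(M\kappa)}$ whenever this formula defines a character of $\Gamma_L$. -/

import Mathlib

open MeasureTheory Matrix

noncomputable section

/-! ## Unitary induction from a normal subgroup

For a normal subgroup `N` of `G` the right coset space `N \ G` coincides with the quotient group
`G ⧸ N`. Given a unitary character `χ` of `N` and a right-invariant measure `ν` on `G ⧸ N`,
the induced representation acts by right translation on the measurable functions `φ : G → ℂ` with
`φ (n x) = χ n * φ x` which are square-integrable modulo `N`, two such functions being
identified when their difference has norm zero. -/

section Induction

variable {G : Type*} [Group G]

/-- `φ (n x) = χ n * φ x` for all `n ∈ N` and all `x ∈ G`. -/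
def IsEquivariant (N : Subgroup G) (χ : N →* Circle) (φ : G → ℂ) : Prop :=
  ∀ (n : N) (x : G), φ ((n : G) * x) = (χ n : ℂ) * φ x

/-- For equivariant functions, `conj φ * ψ` is a function of the coset only. -/
theorem IsEquivariant.conj_mul_out {N : Subgroup G} [N.Normal] {χ : N →* Circle} {φ ψ : G → ℂ}
    (hφ : IsEquivariant N χ φ) (hψ : IsEquivariant N χ ψ) (x : G) :
    star (φ (x : G ⧸ N).out) * ψ (x : G ⧸ N).out = star (φ x) * ψ x := by
  obtain ⟨n, hn⟩ := QuotientGroup.mk_out_eq_mul N x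
  have h1 : (x : G ⧸ N).out = ((⟨x * n * x⁻¹, ‹N.Normal›.conj_mem n n.2 x⟩ : N) : G) * x := by
    rw [hn]; simp
  rw [h1, hφ, hψ]
  set c := χ ⟨x * n * x⁻¹, ‹N.Normal›.conj_mem n n.2 x⟩
  have hc : star (c : ℂ) * (c : ℂ) = 1 := by
    have := Complex.conj_mul' (c : ℂ)
    rw [Circle.norm_coe] at this
    simpa using this
  rw [star_mul]
  linear_combination (star (φ x) * ψ x) * hc

/-- For an equivariant function, `‖φ‖` is a function of the coset only. -/
theorem IsEquivariant.enorm_out {N : Subgroup G} [N.Normal] {χ : N →* Circle} {φ : G → ℂ}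
    (hφ : IsEquivariant N χ φ) (x : G) : ‖φ (x : G ⧸ N).out‖ₑ = ‖φ x‖ₑ := by
  obtain ⟨n, hn⟩ := QuotientGroup.mk_out_eq_mul N x
  have h1 : (x : G ⧸ N).out = ((⟨x * n * x⁻¹, ‹N.Normal›.conj_mem n n.2 x⟩ : N) : G) * x := by
    rw [hn]; simp
  rw [h1, hφ, enorm_mul, ← ofReal_norm (χ _ : ℂ), Circle.norm_coe]
  simp

variable [MeasurableSpace G]

theorem IsEquivariant.measurable_enorm_out {N : Subgroup G} [N.Normal] {χ : N →* Circle}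
    {φ : G → ℂ} (hφ : IsEquivariant N χ φ) (hm : Measurable φ) :
    Measurable fun x : G ⧸ N => ‖φ x.out‖ₑ := by
  refine measurable_from_quotient.2 ?_
  have : ((fun x : G ⧸ N => ‖φ x.out‖ₑ) ∘ Quotient.mk'') = fun x : G => ‖φ x‖ₑ := by
    funext x; exact hφ.enorm_out x
  rw [this]; exact hm.enorm

theorem IsEquivariant.measurable_conj_mul_out {N : Subgroup G} [N.Normal] {χ : N →* Circle}
    {φ ψ : G → ℂ} (hφ : IsEquivariant N χ φ) (hψ : IsEquivariant N χ ψ)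
    (hm : Measurable φ) (hm' : Measurable ψ) :
    Measurable fun x : G ⧸ N => star (φ x.out) * ψ x.out := by
  refine measurable_from_quotient.2 ?_
  have : ((fun x : G ⧸ N => star (φ x.out) * ψ x.out) ∘ Quotient.mk'')
      = fun x : G => star (φ x) * ψ x := by
    funext x; exact hφ.conj_mul_out hψ x
  rw [this]; exact (continuous_star.measurable.comp hm).mul hm'

variable (N : Subgroup G) [N.Normal] (χ : N →* Circle) (ν : Measure (G ⧸ N))

/-- The measurable equivariant functions `φ` on `G` with `∫_{N \ G} |φ|² dν < ∞`. The integrand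
`‖φ x.out‖ₑ ^ 2` does not depend on the chosen representative `x.out` of the coset `x`. -/
def inducedFunctions : Submodule ℂ (G → ℂ) where
  carrier := {φ | Measurable φ ∧ IsEquivariant N χ φ ∧ ∫⁻ x : G ⧸ N, ‖φ x.out‖ₑ ^ 2 ∂ν < ⊤}
  zero_mem' := ⟨measurable_const, fun n x => by simp, by simp⟩
  add_mem' := by
    rintro φ ψ ⟨h1, h2, h3⟩ ⟨k1, k2, k3⟩
    refine ⟨h1.add k1, fun n x => by simp only [Pi.add_apply, h2 n x, k2 n x, mul_add], ?_⟩
    have hle : ∀ x : G ⧸ N, ‖(φ + ψ) x.out‖ₑ ^ 2 ≤ 2 * ‖φ x.out‖ₑ ^ 2 + 2 * ‖ψ x.out‖ₑ ^ 2 := by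
      intro x
      have h := enorm_add_le (φ x.out) (ψ x.out)
      calc ‖(φ + ψ) x.out‖ₑ ^ 2 ≤ (‖φ x.out‖ₑ + ‖ψ x.out‖ₑ) ^ 2 := by
            gcongr; exact h
        _ ≤ 2 * ‖φ x.out‖ₑ ^ 2 + 2 * ‖ψ x.out‖ₑ ^ 2 := by
            have := ENNReal.rpow_add_le_mul_rpow_add_rpow ‖φ x.out‖ₑ ‖ψ x.out‖ₑ
              (p := 2) (by norm_num)
            norm_num at this
            rw [← mul_add]; exact this
    refine lt_of_le_of_lt (lintegral_mono hle) ?_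
    rw [lintegral_add_left ((h2.measurable_enorm_out h1).pow_const 2 |>.const_mul 2),
      lintegral_const_mul' _ _ (by norm_num), lintegral_const_mul' _ _ (by norm_num)]
    exact ENNReal.add_lt_top.2 ⟨ENNReal.mul_lt_top (by norm_num) h3,
      ENNReal.mul_lt_top (by norm_num) k3⟩
  smul_mem' := by
    rintro c φ ⟨h1, h2, h3⟩
    refine ⟨h1.const_smul c, fun n x => ?_, ?_⟩
    · simp only [Pi.smul_apply, h2 n x, smul_eq_mul]; ring
    · have : ∀ x : G ⧸ N, ‖(c • φ) x.out‖ₑ ^ 2 = ‖c‖ₑ ^ 2 * ‖φ x.out‖ₑ ^ 2 := by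
        intro x; rw [Pi.smul_apply, smul_eq_mul, enorm_mul, mul_pow]
      simp_rw [this]
      rw [lintegral_const_mul' _ _ (by simp)]
      exact ENNReal.mul_lt_top (by simp) h3

/-- The space of square-integrable equivariant functions, before identifying functions which
differ by a null function (a copy of `inducedFunctions` without the topology of `G → ℂ`). -/
def PreInduced : Type _ := inducedFunctions N χ ν

instance : AddCommGroup (PreInduced N χ ν) := inferInstanceAs (AddCommGroup (inducedFunctions N χ ν))
instance : Module ℂ (PreInduced N χ ν) := inferInstanceAs (Module ℂ (inducedFunctions N χ ν))

variable {N χ ν}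

/-- The underlying function on `G`. -/
def PreInduced.fn (φ : PreInduced N χ ν) : G → ℂ := φ.1

@[simp] theorem PreInduced.fn_add (φ ψ : PreInduced N χ ν) (x : G) :
    (φ + ψ).fn x = φ.fn x + ψ.fn x := rfl
@[simp] theorem PreInduced.fn_smul (c : ℂ) (φ : PreInduced N χ ν) (x : G) :
    (c • φ).fn x = c * φ.fn x := rfl

theorem PreInduced.integrable (φ ψ : PreInduced N χ ν) :
    Integrable (fun x : G ⧸ N => star (φ.fn x.out) * ψ.fn x.out) ν := by
  obtain ⟨h1, h2, h3⟩ := φ.2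
  obtain ⟨k1, k2, k3⟩ := ψ.2
  refine ⟨(h2.measurable_conj_mul_out k2 h1 k1).aestronglyMeasurable, ?_⟩
  have hle : ∀ x : G ⧸ N, ‖star (φ.fn x.out) * ψ.fn x.out‖ₑ
      ≤ ‖φ.fn x.out‖ₑ ^ 2 + ‖ψ.fn x.out‖ₑ ^ 2 := by
    intro x
    rw [enorm_mul]
    have hs : ‖star (φ.fn x.out)‖ₑ = ‖φ.fn x.out‖ₑ := by simp [← ofReal_norm]
    rw [hs, sq, sq]
    rcases le_total ‖φ.fn x.out‖ₑ ‖ψ.fn x.out‖ₑ with h | h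
    · exact (mul_le_mul_left h _).trans le_add_self
    · exact (mul_le_mul_right h _).trans le_self_add
  refine lt_of_le_of_lt (lintegral_mono hle) ?_
  have h4 : Measurable fun x : G ⧸ N => ‖φ.fn x.out‖ₑ ^ 2 :=
    (h2.measurable_enorm_out h1).pow_const 2
  rw [lintegral_add_left h4]
  exact ENNReal.add_lt_top.2 ⟨h3, k3⟩

variable (N χ ν)

/-- The inner product `⟪φ, ψ⟫ = ∫_{N \ G} conj φ * ψ dν`. -/
@[reducible] def preInducedCore : PreInnerProductSpace.Core ℂ (PreInduced N χ ν) where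
  inner φ ψ := ∫ x : G ⧸ N, star (φ.fn x.out) * ψ.fn x.out ∂ν
  conj_inner_symm φ ψ := by
    rw [← integral_conj]
    congr 1; funext x
    simp [mul_comm]
  re_inner_nonneg φ := by
    have : ∀ x : G ⧸ N, star (φ.fn x.out) * φ.fn x.out = ((‖φ.fn x.out‖ ^ 2 : ℝ) : ℂ) := by
      intro x
      have := Complex.conj_mul' (φ.fn x.out)
      simpa using this
    simp_rw [this]
    rw [integral_complex_ofReal]
    exact integral_nonneg fun x => by positivity
  add_left φ ψ θ := by
    rw [← integral_add (φ.integrable θ) (ψ.integrable θ)]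
    congr 1; funext x
    simp [add_mul]
  smul_left φ ψ c := by
    rw [← integral_const_mul]
    congr 1; funext x
    simp [mul_assoc]

instance : SeminormedAddCommGroup (PreInduced N χ ν) :=
  @InnerProductSpace.Core.toSeminormedAddCommGroup ℂ _ _ _ _ (preInducedCore N χ ν)

instance : InnerProductSpace ℂ (PreInduced N χ ν) :=
  InnerProductSpace.ofCore (preInducedCore N χ ν)

/-- The Hilbert space of the representation of `G` induced from the character `χ` of `N`. -/
abbrev InducedSpace : Type _ := SeparationQuotient (PreInduced N χ ν)

theorem preInduced_norm_sq (φ : PreInduced N χ ν) :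
    ‖φ‖ ^ 2 = (∫⁻ x : G ⧸ N, ‖φ.fn x.out‖ₑ ^ 2 ∂ν).toReal := by
  have h0 : ‖φ‖ ^ 2 = (inner ℂ φ φ : ℂ).re := by
    simpa using (inner_self_eq_norm_sq (𝕜 := ℂ) φ).symm
  have h1 : (inner ℂ φ φ : ℂ) = ∫ x : G ⧸ N, star (φ.fn x.out) * φ.fn x.out ∂ν := rfl
  have h2 : ∀ x : G ⧸ N, star (φ.fn x.out) * φ.fn x.out = ((‖φ.fn x.out‖ ^ 2 : ℝ) : ℂ) := by
    intro x
    have := Complex.conj_mul' (φ.fn x.out)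
    simpa using this
  have h3 : Measurable fun x : G ⧸ N => ‖φ.fn x.out‖ ^ 2 := by
    have := ((φ.2.2.1.measurable_enorm_out φ.2.1).ennreal_toReal).pow_const 2
    simp only [toReal_enorm] at this
    exact this
  rw [h0, h1]
  simp_rw [h2]
  rw [integral_complex_ofReal, Complex.ofReal_re,
    integral_eq_lintegral_of_nonneg_ae (.of_forall fun x => by positivity)
      h3.aestronglyMeasurable]
  congr 2; funext x
  rw [ENNReal.ofReal_pow (norm_nonneg _), ofReal_norm]

variable [MeasurableMul G] [ν.IsMulRightInvariant]

theorem lintegral_translate {φ : G → ℂ} (hφ : IsEquivariant N χ φ) (hm : Measurable φ) (g : G) :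
    ∫⁻ x : G ⧸ N, ‖φ (x.out * g)‖ₑ ^ 2 ∂ν = ∫⁻ x : G ⧸ N, ‖φ x.out‖ₑ ^ 2 ∂ν := by
  have hmeas : Measurable fun x : G ⧸ N => x * (g : G ⧸ N) :=
    measurable_from_quotient.2 (measurable_quotient_mk''.comp (measurable_mul_const g))
  have h : ∀ x : G ⧸ N, ‖φ (x.out * g)‖ₑ = ‖φ (x * (g : G ⧸ N)).out‖ₑ := by
    intro x
    rw [← hφ.enorm_out (x.out * g), QuotientGroup.mk_mul, QuotientGroup.out_eq']
  simp_rw [h]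
  rw [← lintegral_map (f := fun x : G ⧸ N => ‖φ x.out‖ₑ ^ 2)
    ((hφ.measurable_enorm_out hm).pow_const 2) hmeas, map_mul_right_eq_self]

/-- Right translation `φ ↦ (x ↦ φ (x g))` on the square-integrable equivariant functions. -/
def preInducedTranslate (g : G) : PreInduced N χ ν →ₗ[ℂ] PreInduced N χ ν where
  toFun φ := ⟨fun x => φ.fn (x * g), φ.2.1.comp (measurable_mul_const g),
    fun n x => (congrArg φ.fn (mul_assoc _ _ _)).trans (φ.2.2.1 n (x * g)),
    (lintegral_translate N χ ν φ.2.2.1 φ.2.1 g).trans_lt φ.2.2.2⟩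
  map_add' _ _ := rfl
  map_smul' _ _ := rfl

@[simp] theorem preInducedTranslate_fn (g : G) (φ : PreInduced N χ ν) (x : G) :
    (preInducedTranslate N χ ν g φ).fn x = φ.fn (x * g) := rfl

theorem preInducedTranslate_norm (g : G) (φ : PreInduced N χ ν) :
    ‖preInducedTranslate N χ ν g φ‖ = ‖φ‖ := by
  have h : ‖preInducedTranslate N χ ν g φ‖ ^ 2 = ‖φ‖ ^ 2 := by
    rw [preInduced_norm_sq, preInduced_norm_sq]
    congr 1
    exact lintegral_translate N χ ν φ.2.2.1 φ.2.1 g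
  exact (sq_eq_sq₀ (norm_nonneg _) (norm_nonneg _)).1 h

theorem preInducedTranslate_isometry (g : G) : Isometry (preInducedTranslate N χ ν g) :=
  AddMonoidHomClass.isometry_of_norm _ (preInducedTranslate_norm N χ ν g)

/-- Right translation on the induced Hilbert space. -/
def inducedTranslate (g : G) : InducedSpace N χ ν → InducedSpace N χ ν :=
  SeparationQuotient.lift (fun φ => SeparationQuotient.mk (preInducedTranslate N χ ν g φ))
    fun _ _ h => SeparationQuotient.mk_eq_mk.2
      (h.map (preInducedTranslate_isometry N χ ν g).continuous)

@[simp] theorem inducedTranslate_mk (g : G) (φ : PreInduced N χ ν) :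
    inducedTranslate N χ ν g (SeparationQuotient.mk φ) =
      SeparationQuotient.mk (preInducedTranslate N χ ν g φ) := rfl

theorem inducedTranslate_one (v : InducedSpace N χ ν) : inducedTranslate N χ ν 1 v = v := by
  obtain ⟨φ, rfl⟩ := SeparationQuotient.surjective_mk v
  rw [inducedTranslate_mk]
  congr 1
  exact Subtype.ext (funext fun x => congrArg φ.fn (mul_one x))

theorem inducedTranslate_mul (g g' : G) (v : InducedSpace N χ ν) :
    inducedTranslate N χ ν (g * g') v = inducedTranslate N χ ν g (inducedTranslate N χ ν g' v) := by
  obtain ⟨φ, rfl⟩ := SeparationQuotient.surjective_mk v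
  simp only [inducedTranslate_mk]
  congr 1
  exact Subtype.ext (funext fun x => congrArg φ.fn (mul_assoc x g g').symm)

/-- The induced representation `Ind_N^G χ`, a homomorphism from `G` to the unitary group of
`InducedSpace N χ ν`, acting by `(π(g) φ)(x) = φ (x g)`. -/
def inducedRep : G →* (InducedSpace N χ ν ≃ₗᵢ[ℂ] InducedSpace N χ ν) where
  toFun g :=
    { toFun := inducedTranslate N χ ν g
      invFun := inducedTranslate N χ ν g⁻¹
      left_inv := fun v => by
        rw [← inducedTranslate_mul, inv_mul_cancel, inducedTranslate_one]
      right_inv := fun v => by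
        rw [← inducedTranslate_mul, mul_inv_cancel, inducedTranslate_one]
      map_add' := fun v w => by
        obtain ⟨φ, rfl⟩ := SeparationQuotient.surjective_mk v
        obtain ⟨ψ, rfl⟩ := SeparationQuotient.surjective_mk w
        rw [← SeparationQuotient.mk_add, inducedTranslate_mk, map_add, SeparationQuotient.mk_add]
        rfl
      map_smul' := fun c v => by
        obtain ⟨φ, rfl⟩ := SeparationQuotient.surjective_mk v
        rw [← SeparationQuotient.mk_smul, inducedTranslate_mk, map_smul,
          SeparationQuotient.mk_smul]
        rfl
      norm_map' := fun v => by
        obtain ⟨φ, rfl⟩ := SeparationQuotient.surjective_mk v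
        exact preInducedTranslate_norm N χ ν g φ }
  map_one' := LinearIsometryEquiv.ext (inducedTranslate_one N χ ν)
  map_mul' g g' := LinearIsometryEquiv.ext (inducedTranslate_mul N χ ν g g')

end Induction

/-! ## Unitary equivalence -/

section Equivalence

variable {G : Type*} [Group G] {V W : Type*}
  [NormedAddCommGroup V] [InnerProductSpace ℂ V] [NormedAddCommGroup W] [InnerProductSpace ℂ W]

/-- The representation `π` is unitarily equivalent to the Hilbert direct sum of `n` copies of `U`:
there is a surjective linear isometry onto `W ⊕ ⋯ ⊕ W` which intertwines `π` with the
componentwise action of `U`. -/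
def UnitarilyEquivalentToCopies (π : G →* (V ≃ₗᵢ[ℂ] V)) (U : G →* (W ≃ₗᵢ[ℂ] W)) (n : ℕ) : Prop :=
  ∃ T : V ≃ₗᵢ[ℂ] PiLp 2 (fun _ : Fin n => W), ∀ (x : G) (v : V) (i : Fin n),
    T (π x v) i = U x (T v i)

end Equivalence

/-! ## The Heisenberg group -/

/-- The Heisenberg group `H_ℝ^{(g,h)}`: triples `(λ, μ, κ)` of real matrices of sizes `h × g`,
`h × g`, `h × h` with `κ + μ ᵗλ` symmetric. -/
@[ext] structure Heisenberg (g h : ℕ) where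
  lam : Matrix (Fin h) (Fin g) ℝ
  mu : Matrix (Fin h) (Fin g) ℝ
  kappa : Matrix (Fin h) (Fin h) ℝ
  symm : (kappa + mu * lamᵀ).IsSymm

namespace Heisenberg

variable {g h : ℕ}

/-- `(λ,μ,κ) ∘ (λ',μ',κ') = (λ + λ', μ + μ', κ + κ' + λ ᵗμ' - μ ᵗλ')`. -/
instance : Mul (Heisenberg g h) where
  mul x y :=
    { lam := x.lam + y.lam
      mu := x.mu + y.mu
      kappa := x.kappa + y.kappa + x.lam * y.muᵀ - x.mu * y.lamᵀ
      symm := by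
        have hx := x.symm
        have hy := y.symm
        unfold Matrix.IsSymm at *
        simp only [transpose_add, transpose_sub, transpose_mul, transpose_transpose,
          Matrix.add_mul, Matrix.mul_add] at *
        rw [sub_eq_add_neg, ← sub_eq_zero] at *
        rw [← add_zero (0 : Matrix (Fin h) (Fin h) ℝ)]
        nth_rw 1 [← hx]
        rw [← hy]
        abel }

instance : One (Heisenberg g h) := ⟨⟨0, 0, 0, by simp [Matrix.IsSymm]⟩⟩

instance : Inv (Heisenberg g h) where
  inv x :=
    { lam := -x.lam
      mu := -x.mu
      kappa := -x.kappa + x.lam * x.muᵀ - x.mu * x.lamᵀ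
      symm := by
        have hx := x.symm
        unfold Matrix.IsSymm at *
        simp only [transpose_add, transpose_sub, transpose_mul, transpose_transpose,
          transpose_neg, Matrix.neg_mul, Matrix.mul_neg] at *
        rw [← sub_eq_zero] at *
        rw [← neg_zero (G := Matrix (Fin h) (Fin h) ℝ), ← hx]
        abel }

@[simp] theorem lam_mul (x y : Heisenberg g h) : (x * y).lam = x.lam + y.lam := rfl
@[simp] theorem mu_mul (x y : Heisenberg g h) : (x * y).mu = x.mu + y.mu := rfl
@[simp] theorem kappa_mul (x y : Heisenberg g h) :
    (x * y).kappa = x.kappa + y.kappa + x.lam * y.muᵀ - x.mu * y.lamᵀ := rfl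
@[simp] theorem lam_one : (1 : Heisenberg g h).lam = 0 := rfl
@[simp] theorem mu_one : (1 : Heisenberg g h).mu = 0 := rfl
@[simp] theorem kappa_one : (1 : Heisenberg g h).kappa = 0 := rfl
@[simp] theorem lam_inv (x : Heisenberg g h) : x⁻¹.lam = -x.lam := rfl
@[simp] theorem mu_inv (x : Heisenberg g h) : x⁻¹.mu = -x.mu := rfl
@[simp] theorem kappa_inv (x : Heisenberg g h) :
    x⁻¹.kappa = -x.kappa + x.lam * x.muᵀ - x.mu * x.lamᵀ := rfl

instance : Group (Heisenberg g h) :=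
  Group.ofLeftAxioms
    (fun x y z => by
      ext1
      · simp [add_assoc]
      · simp [add_assoc]
      · simp only [kappa_mul, lam_mul, mu_mul, transpose_add, Matrix.add_mul, Matrix.mul_add]
        abel)
    (fun x => by ext1 <;> simp)
    (fun x => by
      ext1
      · simp
      · simp
      · simp only [kappa_mul, lam_inv, mu_inv, kappa_inv, kappa_one, Matrix.neg_mul]
        abel)

/-- The embedding in the space of all triples of matrices. -/
def toTriple (x : Heisenberg g h) :
    Matrix (Fin h) (Fin g) ℝ × Matrix (Fin h) (Fin g) ℝ × Matrix (Fin h) (Fin h) ℝ :=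
  (x.lam, x.mu, x.kappa)

instance : TopologicalSpace (Heisenberg g h) := TopologicalSpace.induced toTriple inferInstance
instance : MeasurableSpace (Heisenberg g h) := borel _
instance : BorelSpace (Heisenberg g h) := ⟨rfl⟩

theorem continuous_toTriple : Continuous (toTriple (g := g) (h := h)) := continuous_induced_dom

theorem continuous_lam : Continuous (lam (g := g) (h := h)) := continuous_toTriple.fst
theorem continuous_mu : Continuous (mu (g := g) (h := h)) := continuous_toTriple.snd.fst
theorem continuous_kappa : Continuous (kappa (g := g) (h := h)) := continuous_toTriple.snd.snd

instance : IsTopologicalGroup (Heisenberg g h) where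
  continuous_mul := continuous_induced_rng.2 <| by
    have l1 := continuous_lam.comp (continuous_fst (X := Heisenberg g h) (Y := Heisenberg g h))
    have l2 := continuous_lam.comp (continuous_snd (X := Heisenberg g h) (Y := Heisenberg g h))
    have m1 := continuous_mu.comp (continuous_fst (X := Heisenberg g h) (Y := Heisenberg g h))
    have m2 := continuous_mu.comp (continuous_snd (X := Heisenberg g h) (Y := Heisenberg g h))
    have k1 := continuous_kappa.comp (continuous_fst (X := Heisenberg g h) (Y := Heisenberg g h))
    have k2 := continuous_kappa.comp (continuous_snd (X := Heisenberg g h) (Y := Heisenberg g h))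
    exact (l1.add l2).prodMk ((m1.add m2).prodMk
      (((k1.add k2).add (l1.matrix_mul m2.matrix_transpose)).sub
        (m1.matrix_mul l2.matrix_transpose)))
  continuous_inv := continuous_induced_rng.2 <|
    continuous_lam.neg.prodMk (continuous_mu.neg.prodMk
      ((continuous_kappa.neg.add (continuous_lam.matrix_mul continuous_mu.matrix_transpose)).sub
        (continuous_mu.matrix_mul continuous_lam.matrix_transpose)))

theorem isClosedEmbedding_toTriple :
    Topology.IsClosedEmbedding (toTriple (g := g) (h := h)) where
  eq_induced := rfl
  injective x y hxy := by
    simp only [toTriple, Prod.mk.injEq] at hxy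
    exact Heisenberg.ext hxy.1 hxy.2.1 hxy.2.2
  isClosed_range := by
    have : Set.range (toTriple (g := g) (h := h)) =
        {p | (p.2.2 + p.2.1 * p.1ᵀ)ᵀ = p.2.2 + p.2.1 * p.1ᵀ} := by
      ext p
      constructor
      · rintro ⟨x, rfl⟩
        exact x.symm
      · intro hp
        exact ⟨⟨p.1, p.2.1, p.2.2, hp⟩, rfl⟩
    rw [this]
    have hc : Continuous fun p : Matrix (Fin h) (Fin g) ℝ × Matrix (Fin h) (Fin g) ℝ ×
        Matrix (Fin h) (Fin h) ℝ => p.2.2 + p.2.1 * p.1ᵀ :=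
      continuous_snd.snd.add (continuous_snd.fst.matrix_mul continuous_fst.matrix_transpose)
    exact isClosed_eq hc.matrix_transpose hc

instance : LocallyCompactSpace (Heisenberg g h) :=
  haveI : LocallyCompactSpace (Matrix (Fin h) (Fin g) ℝ) :=
    inferInstanceAs (LocallyCompactSpace (Fin h → Fin g → ℝ))
  haveI : LocallyCompactSpace (Matrix (Fin h) (Fin h) ℝ) :=
    inferInstanceAs (LocallyCompactSpace (Fin h → Fin h → ℝ))
  isClosedEmbedding_toTriple.locallyCompactSpace

instance : PolishSpace (Heisenberg g h) :=
  haveI : PolishSpace (Matrix (Fin h) (Fin g) ℝ) :=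
    inferInstanceAs (PolishSpace (Fin h → Fin g → ℝ))
  haveI : PolishSpace (Matrix (Fin h) (Fin h) ℝ) :=
    inferInstanceAs (PolishSpace (Fin h → Fin h → ℝ))
  isClosedEmbedding_toTriple.polishSpace

/-- The bracket coordinate `κ + μ ᵗλ`: in the notation `[λ, μ, κ] := (0, μ, κ) ∘ (λ, 0, 0)`
one has `x = [x.lam, x.mu, x.bracket]`. -/
def bracket (x : Heisenberg g h) : Matrix (Fin h) (Fin h) ℝ := x.kappa + x.mu * x.lamᵀ

theorem bracket_mul (x y : Heisenberg g h) :
    (x * y).bracket = x.bracket + y.bracket + (x.lam * y.muᵀ + (x.lam * y.muᵀ)ᵀ) := by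
  simp only [bracket, kappa_mul, lam_mul, mu_mul, transpose_add, transpose_mul,
    transpose_transpose, Matrix.add_mul, Matrix.mul_add]
  abel

end Heisenberg

/-! ## The two inducing subgroups and their characters -/

section Subgroups

variable (g h : ℕ)

/-- A real matrix with integral entries. -/
def IsIntegralMatrix {m n : ℕ} (A : Matrix (Fin m) (Fin n) ℝ) : Prop :=
  ∃ B : Matrix (Fin m) (Fin n) ℤ, A = B.map (Int.cast : ℤ → ℝ)

/-- `Γ_L = {(λ, μ, κ) : λ, μ integral, κ real}`. -/
def latticeSubgroup : Subgroup (Heisenberg g h) where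
  carrier := {x | IsIntegralMatrix x.lam ∧ IsIntegralMatrix x.mu}
  one_mem' := ⟨⟨0, by simp⟩, ⟨0, by simp⟩⟩
  mul_mem' := by
    rintro x y ⟨⟨a, ha⟩, ⟨b, hb⟩⟩ ⟨⟨c, hc⟩, ⟨d, hd⟩⟩
    refine ⟨⟨a + c, ?_⟩, ⟨b + d, ?_⟩⟩
    · ext i j; simp [ha, hc]
    · ext i j; simp [hb, hd]
  inv_mem' := by
    rintro x ⟨⟨a, ha⟩, ⟨b, hb⟩⟩
    refine ⟨⟨-a, ?_⟩, ⟨-b, ?_⟩⟩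
    · ext i j; simp [ha]
    · ext i j; simp [hb]

/-- `K = {(0, μ, κ)}` (so that `κ` is symmetric). -/
def polarizationSubgroup : Subgroup (Heisenberg g h) where
  carrier := {x | x.lam = 0}
  one_mem' := rfl
  mul_mem' := by
    intro x y hx hy
    simp only [Set.mem_ofPred_eq] at *
    simp [hx, hy]
  inv_mem' := by
    intro x hx
    simp only [Set.mem_ofPred_eq] at *
    simp [hx]

instance : (latticeSubgroup g h).Normal where
  conj_mem n hn x := by
    have h1 : (x * n * x⁻¹).lam = n.lam := by simp
    have h2 : (x * n * x⁻¹).mu = n.mu := by simp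
    exact ⟨h1 ▸ hn.1, h2 ▸ hn.2⟩

instance : (polarizationSubgroup g h).Normal where
  conj_mem n hn x := by
    have h1 : (x * n * x⁻¹).lam = n.lam := by simp
    exact h1.trans hn

theorem isClosed_isIntegralMatrix {m n : ℕ} :
    IsClosed {A : Matrix (Fin m) (Fin n) ℝ | IsIntegralMatrix A} := by
  have : {A : Matrix (Fin m) (Fin n) ℝ | IsIntegralMatrix A} =
      ⋂ i, ⋂ j, {A | A i j ∈ Set.range (Int.cast : ℤ → ℝ)} := by
    ext A
    simp only [Set.mem_iInter]
    constructor
    · rintro ⟨B, rfl⟩ i j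
      exact ⟨B i j, rfl⟩
    · intro hA
      choose B hB using hA
      exact ⟨Matrix.of B, by ext i j; exact (hB i j).symm⟩
  rw [this]
  exact isClosed_iInter fun i => isClosed_iInter fun j =>
    Int.isClosedEmbedding_coe_real.isClosed_range.preimage
      ((continuous_apply j).comp (continuous_apply i))

instance : IsClosed (latticeSubgroup g h : Set (Heisenberg g h)) :=
  (isClosed_isIntegralMatrix.preimage Heisenberg.continuous_lam).inter
    (isClosed_isIntegralMatrix.preimage Heisenberg.continuous_mu)

instance : IsClosed (polarizationSubgroup g h : Set (Heisenberg g h)) :=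
  isClosed_eq Heisenberg.continuous_lam continuous_const

/-- A left-invariant measure on either quotient is also right-invariant: the quotient groups are
commutative. -/
theorem isMulRightInvariant_of_comm {Q : Type*} [Group Q] [MeasurableSpace Q]
    (hQ : ∀ x y : Q, x * y = y * x) (ν : Measure Q) [ν.IsMulLeftInvariant] :
    ν.IsMulRightInvariant :=
  ⟨fun x => by simpa only [hQ] using map_mul_left_eq_self ν x⟩

instance (ν : Measure (Heisenberg g h ⧸ latticeSubgroup g h)) [ν.IsMulLeftInvariant] :
    ν.IsMulRightInvariant :=
  isMulRightInvariant_of_comm (fun a b => by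
    induction a using QuotientGroup.induction_on with | _ x => ?_
    induction b using QuotientGroup.induction_on with | _ y => ?_
    rw [← QuotientGroup.mk_mul, ← QuotientGroup.mk_mul, QuotientGroup.eq]
    refine ⟨⟨0, ?_⟩, ⟨0, ?_⟩⟩ <;> simp <;> abel) ν

instance (ν : Measure (Heisenberg g h ⧸ polarizationSubgroup g h)) [ν.IsMulLeftInvariant] :
    ν.IsMulRightInvariant :=
  isMulRightInvariant_of_comm (fun a b => by
    induction a using QuotientGroup.induction_on with | _ x => ?_
    induction b using QuotientGroup.induction_on with | _ y => ?_
    rw [← QuotientGroup.mk_mul, ← QuotientGroup.mk_mul, QuotientGroup.eq]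
    show (_ : Matrix (Fin h) (Fin g) ℝ) = 0
    simp only [Heisenberg.lam_mul, Heisenberg.lam_inv]
    abel) ν

variable {g h}

/-- Half-integral symmetric matrices: symmetric, with integral diagonal entries and off-diagonal
entries in `½ ℤ`. -/
structure IsHalfIntegral (M : Matrix (Fin h) (Fin h) ℝ) : Prop where
  isSymm : M.IsSymm
  diag : ∀ i, ∃ n : ℤ, M i i = n
  two_mul : ∀ i j, ∃ n : ℤ, 2 * M i j = n

/-- `σ_M (0, μ, κ) = exp (2πi tr(Mκ))`. -/
def schrodingerChar (M : Matrix (Fin h) (Fin h) ℝ) : polarizationSubgroup g h →* Circle where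
  toFun x := Circle.exp (2 * Real.pi * (M * x.1.kappa).trace)
  map_one' := by simp
  map_mul' x y := by
    have hx : x.1.lam = 0 := x.2
    have hy : y.1.lam = 0 := y.2
    simp only [Subgroup.coe_mul, Heisenberg.kappa_mul, hx, hy, Matrix.zero_mul, transpose_zero,
      Matrix.mul_zero, add_zero, sub_zero, Matrix.mul_add, trace_add]
    rw [mul_add, Circle.exp_add]

theorem IsHalfIntegral.exists_trace {M : Matrix (Fin h) (Fin h) ℝ} (hM : IsHalfIntegral M)
    {A B : Matrix (Fin h) (Fin g) ℝ} (hA : IsIntegralMatrix A) (hB : IsIntegralMatrix B) :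
    ∃ n : ℤ, (M * (A * Bᵀ + (A * Bᵀ)ᵀ)).trace = n := by
  obtain ⟨a, rfl⟩ := hA
  obtain ⟨b, rfl⟩ := hB
  choose m hm using hM.two_mul
  set X : Matrix (Fin h) (Fin h) ℝ := a.map (Int.cast : ℤ → ℝ) * (b.map (Int.cast : ℤ → ℝ))ᵀ
    with hX
  have h1 : (M * Xᵀ).trace = (M * X).trace := by
    rw [← trace_transpose, transpose_mul, transpose_transpose, hM.isSymm.eq, trace_mul_comm]
  have h2 : (M * (X + Xᵀ)).trace = ∑ i, ∑ j, 2 * M i j * X j i := by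
    rw [Matrix.mul_add, trace_add, h1, ← _root_.two_mul]
    simp only [trace, diag_apply, Matrix.mul_apply, Finset.mul_sum, mul_assoc]
  refine ⟨∑ i, ∑ j, m i j * (a * bᵀ) j i, ?_⟩
  rw [h2]
  push_cast
  refine Finset.sum_congr rfl fun i _ => Finset.sum_congr rfl fun j _ => ?_
  rw [hm i j, hX]
  simp [Matrix.mul_apply]

/-- The character `φ_M [λ, μ, κ] = exp (2πi tr(Mκ))` of `Γ_L`, that is,
`φ_M (λ, μ, κ) = exp (2πi tr(M(κ + μ ᵗλ)))`. -/
def latticeChar (M : Matrix (Fin h) (Fin h) ℝ) (hM : IsHalfIntegral M) :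
    latticeSubgroup g h →* Circle where
  toFun x := Circle.exp (2 * Real.pi * (M * x.1.bracket).trace)
  map_one' := by simp [Heisenberg.bracket]
  map_mul' x y := by
    obtain ⟨n, hn⟩ := hM.exists_trace x.2.1 y.2.2
    rw [Subgroup.coe_mul, Heisenberg.bracket_mul, Matrix.mul_add, Matrix.mul_add, trace_add,
      trace_add, hn, mul_add, mul_add, Circle.exp_add, Circle.exp_add]
    have : Circle.exp (2 * Real.pi * n) = 1 := by
      rw [mul_comm]; exact Circle.exp_int_mul_two_pi n
    rw [this, mul_one]

end Subgroups

end

/-!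
Write `e(t) = exp(2πi t)` and `N · μ = ∑ N_ij μ_ij`. Realize the Schrödinger representation
`Ind_K σ_M` on functions of `λ` and the lattice representation on functions of `(λ, μ)`.
A function `F` in the space of the latter is periodic
in `μ`, hence a Fourier series `∑_N c_N(λ) e(N · μ)` over the integral `h × g` matrices `N`, and its
transformation law in `λ` reads `c_N(λ + a) = c_{N + 2Ma}(λ)` for integral `a`. So for each class
`α` of integral matrices modulo `2M ℤ^{h × g}` the coefficients `c_N`, `N ∈ α`, are translates of a
single square-integrable function on `ℝ^{h × g}`, and the number of these classes is
`(det 2M)^g` (`exists_coset_representatives`).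

The equivalence is built in the opposite direction, as a theta series. For a family
`(φ_α)` of functions in the space of the Schrödinger representation with bounded support in `λ`, put
`(θ φ)(x) = ∑_N φ_{[N]}(((2M)⁻¹ N, 0, 0) x)`. This sum is locally finite. It commutes with right
translation because the group acts on the left in its definition, and left multiplication by
an element `[a, b, κ]` of `Γ_L` permutes the summands by `N ↦ N + 2Ma`, up to the factor `φ_M`
(`ThetaData.isEquivariant_theta`). Up to a constant depending on the Haar measures, `θ` is isometric
(`ThetaData.lintegral_theta`): integrating first over `μ` in the torus turns `|θ φ|²` into the sum
of the squares of its Fourier coefficients, and the translates of the unit cube tile the space of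
all `λ`. Functions of bounded support are dense (`denseRange_boundedFunctionsInclusion`), and a
function orthogonal to the range of `θ` has vanishing partial Fourier coefficients, hence is zero
(`ThetaData.denseRange_thetaMapMk`). Both induced spaces are complete, being copies of `L²` of
a space of coset representatives (`CosetSection.completeSpace`), so `θ` extends to a unitary
equivalence.

Finally, `(λ, μ, κ) ↦ e(tr Mκ)` is multiplicative on `Γ_L` only if `tr(M μ ᵗλ)` is an integer for
all integral `λ` and `μ`, in which case it agrees with `φ_M` (`eq_latticeChar`).
-/

noncomputable section

/-! ### Induced spaces and measurable sections of the coset space -/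

section Section

variable {G : Type*} [Group G] [MeasurableSpace G]

theorem PreInduced.measurable_fn {N : Subgroup G} [N.Normal] {χ : N →* Circle}
    {ν : Measure (G ⧸ N)} (φ : PreInduced N χ ν) : Measurable φ.fn := φ.2.1

theorem PreInduced.isEquivariant_fn {N : Subgroup G} [N.Normal] {χ : N →* Circle}
    {ν : Measure (G ⧸ N)} (φ : PreInduced N χ ν) : IsEquivariant N χ φ.fn := φ.2.2.1

theorem PreInduced.lintegral_lt_top {N : Subgroup G} [N.Normal] {χ : N →* Circle}
    {ν : Measure (G ⧸ N)} (φ : PreInduced N χ ν) : ∫⁻ x : G ⧸ N, ‖φ.fn x.out‖ₑ ^ 2 ∂ν < ⊤ :=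
  φ.2.2.2

/-- A parametrization of the cosets of `N` by a measurable space `X`: a measurable map `proj` which
is constant on cosets, and a measurable choice `sec` of a representative of each coset. -/
structure CosetSection (N : Subgroup G) (X : Type*) [MeasurableSpace X] where
  proj : G → X
  sec : X → G
  measurable_proj : Measurable proj
  measurable_sec : Measurable sec
  proj_mul : ∀ (n : N) (x : G), proj ((n : G) * x) = proj x
  proj_sec : ∀ y, proj (sec y) = y
  mul_inv_mem : ∀ x, x * (sec (proj x))⁻¹ ∈ N

namespace CosetSection

variable {N : Subgroup G} {X : Type*} [MeasurableSpace X] (S : CosetSection N X)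

/-- The parametrization as a function on the quotient. -/
def projQuot (z : G ⧸ N) : X := S.proj z.out

theorem norm_apply_sec {χ : N →* Circle} {φ : G → ℂ} (hφ : IsEquivariant N χ φ) (x : G) :
    ‖φ x‖ₑ = ‖φ (S.sec (S.proj x))‖ₑ := by
  have h : x = ((⟨_, S.mul_inv_mem x⟩ : N) : G) * S.sec (S.proj x) := by simp
  conv_lhs => rw [h, hφ]
  rw [enorm_mul, ← ofReal_norm (χ _ : ℂ), Circle.norm_coe]
  simp

theorem conj_mul_apply_sec {χ : N →* Circle} {φ ψ : G → ℂ} (hφ : IsEquivariant N χ φ)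
    (hψ : IsEquivariant N χ ψ) (x : G) :
    star (φ x) * ψ x = star (φ (S.sec (S.proj x))) * ψ (S.sec (S.proj x)) := by
  have h : x = ((⟨_, S.mul_inv_mem x⟩ : N) : G) * S.sec (S.proj x) := by simp
  conv_lhs => rw [h, hφ, hψ]
  set c := χ ⟨_, S.mul_inv_mem x⟩
  have hc : star (c : ℂ) * (c : ℂ) = 1 := by
    have := Complex.conj_mul' (c : ℂ)
    rw [Circle.norm_coe] at this
    simpa using this
  rw [star_mul]
  linear_combination (star (φ (S.sec (S.proj x))) * ψ (S.sec (S.proj x))) * hc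

/-- The equivariant function on `G` with prescribed values on the chosen representatives. -/
def extendFn (χ : N →* Circle) (f : X → ℂ) (x : G) : ℂ := χ ⟨_, S.mul_inv_mem x⟩ * f (S.proj x)

theorem isEquivariant_extendFn (χ : N →* Circle) (f : X → ℂ) : IsEquivariant N χ (S.extendFn χ f) := by
  intro n x
  have : (⟨_, S.mul_inv_mem ((n : G) * x)⟩ : N) = n * ⟨_, S.mul_inv_mem x⟩ := by
    ext; simp [S.proj_mul, mul_assoc]
  rw [extendFn, this, map_mul, Circle.coe_mul, S.proj_mul, mul_assoc]
  rfl

theorem extendFn_sec (χ : N →* Circle) (f : X → ℂ) (y : X) : S.extendFn χ f (S.sec y) = f y := by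
  have : (⟨_, S.mul_inv_mem (S.sec y)⟩ : N) = 1 := by
    ext; simp [S.proj_sec]
  rw [extendFn, this, map_one, Circle.coe_one, one_mul, S.proj_sec]

theorem measurable_extendFn [MeasurableMul₂ G] [MeasurableInv G] {χ : N →* Circle}
    (hχ : Measurable fun n => (χ n : ℂ)) {f : X → ℂ} (hf : Measurable f) :
    Measurable (S.extendFn χ f) := by
  refine Measurable.mul ?_ (hf.comp S.measurable_proj)
  refine hχ.comp (Measurable.subtype_mk ?_)
  exact measurable_id.mul (S.measurable_sec.comp S.measurable_proj).inv

variable [N.Normal]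

theorem projQuot_mk (x : G) : S.projQuot (x : G ⧸ N) = S.proj x := by
  obtain ⟨n, hn⟩ := QuotientGroup.mk_out_eq_mul N x
  have h1 : (x : G ⧸ N).out = ((⟨x * n * x⁻¹, ‹N.Normal›.conj_mem n n.2 x⟩ : N) : G) * x := by
    rw [hn]; simp
  rw [projQuot, h1, S.proj_mul]

theorem measurable_projQuot : Measurable S.projQuot := by
  refine measurable_from_quotient.2 ?_
  have : S.projQuot ∘ Quotient.mk'' = S.proj := by
    funext x; exact S.projQuot_mk x
  rw [this]; exact S.measurable_proj

variable {χ : N →* Circle} {ν : Measure (G ⧸ N)}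

theorem lintegral_eq {φ : G → ℂ} (hφ : IsEquivariant N χ φ) (hm : Measurable φ) :
    ∫⁻ z : G ⧸ N, ‖φ z.out‖ₑ ^ 2 ∂ν = ∫⁻ y, ‖φ (S.sec y)‖ₑ ^ 2 ∂(ν.map S.projQuot) := by
  rw [lintegral_map (f := fun y => ‖φ (S.sec y)‖ₑ ^ 2)
    ((hm.comp S.measurable_sec).enorm.pow_const 2) S.measurable_projQuot]
  refine lintegral_congr fun z => ?_
  rw [S.norm_apply_sec hφ]
  rfl

theorem integral_conj_mul_eq {φ ψ : G → ℂ} (hφ : IsEquivariant N χ φ) (hψ : IsEquivariant N χ ψ)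
    (hm : Measurable φ) (hm' : Measurable ψ) :
    ∫ z : G ⧸ N, star (φ z.out) * ψ z.out ∂ν =
      ∫ y, star (φ (S.sec y)) * ψ (S.sec y) ∂(ν.map S.projQuot) := by
  rw [integral_map S.measurable_projQuot.aemeasurable]
  · refine integral_congr_ae (.of_forall fun z => ?_)
    simp only
    rw [S.conj_mul_apply_sec hφ hψ]
    rfl
  · exact ((continuous_star.measurable.comp (hm.comp S.measurable_sec)).mul
      (hm'.comp S.measurable_sec)).aestronglyMeasurable

theorem norm_sq_eq (φ : PreInduced N χ ν) :
    ‖φ‖ ^ 2 = (∫⁻ y, ‖φ.fn (S.sec y)‖ₑ ^ 2 ∂(ν.map S.projQuot)).toReal := by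
  rw [preInduced_norm_sq]
  congr 1
  exact S.lintegral_eq φ.2.2.1 φ.2.1

theorem inner_eq (φ ψ : PreInduced N χ ν) : (inner ℂ φ ψ : ℂ) =
    ∫ y, star (φ.fn (S.sec y)) * ψ.fn (S.sec y) ∂(ν.map S.projQuot) :=
  S.integral_conj_mul_eq φ.2.2.1 ψ.2.2.1 φ.2.1 ψ.2.1

theorem memLp (φ : PreInduced N χ ν) : MemLp (fun y => φ.fn (S.sec y)) 2 (ν.map S.projQuot) := by
  refine ⟨(φ.2.1.comp S.measurable_sec).aestronglyMeasurable, ?_⟩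
  rw [eLpNorm_lt_top_iff_lintegral_rpow_enorm_lt_top (by norm_num) (by norm_num)]
  have := φ.2.2.2
  rw [S.lintegral_eq φ.2.2.1 φ.2.1] at this
  simp only [ENNReal.toReal_ofNat, ENNReal.rpow_ofNat]
  exact this

/-- Restriction to the representatives identifies the induced space with `L²(X)`, hence the former
is complete. -/
theorem completeSpace [MeasurableMul₂ G] [MeasurableInv G] (S : CosetSection N X)
    (hχ : Measurable fun n => (χ n : ℂ)) : CompleteSpace (PreInduced N χ ν) := by
  let J : PreInduced N χ ν → Lp ℂ 2 (ν.map S.projQuot) := fun φ => (S.memLp φ).toLp _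
  have hiso : Isometry J := by
    refine Isometry.of_dist_eq fun φ ψ => ?_
    rw [dist_eq_norm, dist_eq_norm, ← MemLp.toLp_sub, Lp.norm_toLp,
      ← sq_eq_sq₀ ENNReal.toReal_nonneg (norm_nonneg _), S.norm_sq_eq, ← ENNReal.toReal_pow]
    congr 1
    rw [eLpNorm_eq_lintegral_rpow_enorm_toReal (by norm_num) (by norm_num),
      ← ENNReal.rpow_natCast, ← ENNReal.rpow_mul]
    norm_num
    rfl
  have hsurj : Function.Surjective J := by
    intro f
    have hf := (Lp.stronglyMeasurable f).measurable
    have hmem : S.extendFn χ f ∈ inducedFunctions N χ ν := by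
      refine ⟨S.measurable_extendFn hχ hf, S.isEquivariant_extendFn χ f, ?_⟩
      rw [S.lintegral_eq (S.isEquivariant_extendFn χ f) (S.measurable_extendFn hχ hf)]
      simp only [S.extendFn_sec]
      have := Lp.eLpNorm_lt_top f
      rw [eLpNorm_lt_top_iff_lintegral_rpow_enorm_lt_top (by norm_num) (by norm_num)] at this
      simpa using this
    refine ⟨⟨_, hmem⟩, ?_⟩
    refine (Lp.ext ?_)
    refine (MemLp.coeFn_toLp _).trans (.of_forall fun y => ?_)
    exact S.extendFn_sec χ f y
  rw [hiso.isUniformInducing.completeSpace_congr hsurj]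
  infer_instance

end CosetSection

end Section

/-! ### Fourier analysis on the torus -/

section Torus

section Representatives

variable {d : Type*}

/-- The representative with coordinates in `(0, 1]` of a point of the torus. -/
def torusRep (y : UnitAddTorus d) (i : d) : ℝ := AddCircle.equivIoc 1 0 (y i)

theorem torusRep_mem_Ioc (y : UnitAddTorus d) (i : d) : torusRep y i ∈ Set.Ioc (0 : ℝ) 1 := by
  have h := (AddCircle.equivIoc 1 0 (y i)).2
  exact ⟨h.1, h.2.trans_eq (zero_add 1)⟩

/-- The projection `ℝ^d → (ℝ / ℤ)^d`. -/
def torusMk (x : d → ℝ) : UnitAddTorus d := fun i => (x i : UnitAddCircle)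

theorem torusMk_torusRep (y : UnitAddTorus d) : torusMk (torusRep y) = y :=
  (UnitAddTorus.measurableEquivPiIoc (0 : d → ℝ)).symm_apply_apply y

theorem measurable_torusRep : Measurable (torusRep (d := d)) :=
  measurable_subtype_coe.comp (UnitAddTorus.measurableEquivPiIoc (0 : d → ℝ)).measurable

theorem measurable_torusMk : Measurable (torusMk (d := d)) :=
  measurable_pi_lambda _ fun i => AddCircle.measurable_mk'.comp (measurable_pi_apply i)

theorem continuous_torusMk : Continuous (torusMk (d := d)) :=
  continuous_pi fun i => (AddCircle.continuous_mk' 1).comp (continuous_apply i)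

theorem torusRep_torusMk {x : d → ℝ} (hx : ∀ i, x i ∈ Set.Ioc (0 : ℝ) 1) :
    torusRep (torusMk x) = x := by
  have := (UnitAddTorus.measurableEquivPiIoc (0 : d → ℝ)).apply_symm_apply ⟨x, by simpa using hx⟩
  exact congrArg Subtype.val this

theorem torusMk_eq_iff {x y : d → ℝ} :
    torusMk x = torusMk y ↔ ∃ N : d → ℤ, ∀ i, x i = y i + N i := by
  constructor
  · intro h
    have : ∀ i, ∃ n : ℤ, x i = y i + n := by
      intro i
      have := congrFun h i
      obtain ⟨n, hn⟩ := (QuotientAddGroup.eq_iff_sub_mem.1 this)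
      refine ⟨n, ?_⟩
      simp only [zsmul_eq_mul, mul_one] at hn
      linarith
    choose N hN using this
    exact ⟨N, hN⟩
  · rintro ⟨N, hN⟩
    funext i
    refine QuotientAddGroup.eq_iff_sub_mem.2 ⟨N i, ?_⟩
    simp [hN]

end Representatives

open UnitAddTorus

-- Mathlib's Fourier theory normalizes the circle to have total mass one.
attribute [local instance] instMeasureSpaceUnitAddCircle

variable {d : Type*} [Fintype d]

instance : BorelSpace (UnitAddTorus d × UnitAddTorus d) :=
  haveI : SecondCountableTopology (UnitAddTorus d) := inferInstance
  inferInstance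

variable (d) in
/-- The Haar probability measure of the torus `(ℝ / ℤ)^d`. -/
abbrev torusHaar : Measure (UnitAddTorus d) := volume

instance : IsProbabilityMeasure (torusHaar d) :=
  inferInstanceAs (IsProbabilityMeasure (Measure.pi fun _ : d => AddCircle.haarAddCircle))

instance : (torusHaar d).IsAddHaarMeasure :=
  inferInstanceAs (Measure.pi fun _ : d => AddCircle.haarAddCircle (T := 1)).IsAddHaarMeasure

instance : ((torusHaar d).prod (torusHaar d)).IsAddHaarMeasure :=
  haveI : SecondCountableTopology (UnitAddTorus d) := inferInstance
  Measure.prod.instIsAddHaarMeasure _ _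

/-- Parseval's identity for trigonometric polynomials on the torus. -/
theorem lintegral_norm_sq_trigPolynomial (s : Finset (d → ℤ)) (c : (d → ℤ) → ℂ) :
    ∫⁻ y, ‖∑ N ∈ s, c N * mFourier N y‖ₑ ^ 2 ∂torusHaar d = ∑ N ∈ s, ‖c N‖ₑ ^ 2 := by
  set f := ∑ N ∈ s, c N • mFourierLp (d := d) 2 N with hf
  have h1 : f =ᵐ[torusHaar d] fun y => ∑ N ∈ s, c N * mFourier N y := by
    refine (Lp.coeFn_finsetSum _ _).trans ?_
    have : ∀ᵐ y ∂torusHaar d, ∀ N ∈ s, (c N • mFourierLp (d := d) 2 N) y = c N * mFourier N y := by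
      rw [Filter.eventually_all_finset]
      intro N _
      filter_upwards [Lp.coeFn_smul (c N) (mFourierLp (d := d) 2 N), coeFn_mFourierLp (d := d) 2 N]
        with y h1 h2
      rw [h1, Pi.smul_apply, h2, smul_eq_mul]
    filter_upwards [this] with y hy
    rw [Finset.sum_apply]
    exact Finset.sum_congr rfl hy
  have h2 : ‖f‖ ^ 2 = ∑ N ∈ s, ‖c N‖ ^ 2 := by
    have := orthonormal_mFourier.inner_sum c c s (𝕜 := ℂ) (ι := d → ℤ)
    rw [← hf, inner_self_eq_norm_sq_to_K] at this
    simp only [Complex.conj_mul'] at this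
    apply Complex.ofReal_injective
    push_cast
    exact this
  have h3 : ‖f‖ₑ ^ 2 = ∫⁻ y, ‖f y‖ₑ ^ 2 ∂torusHaar d := by
    rw [Lp.enorm_def, eLpNorm_eq_lintegral_rpow_enorm_toReal (by norm_num) (by norm_num),
      ← ENNReal.rpow_natCast, ← ENNReal.rpow_mul]
    norm_num
  have h4 : ∫⁻ y, ‖f y‖ₑ ^ 2 ∂torusHaar d =
      ∫⁻ y, ‖∑ N ∈ s, c N * mFourier N y‖ₑ ^ 2 ∂torusHaar d :=
    lintegral_congr_ae (h1.mono fun y hy => by simp only [hy])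
  rw [← h4, ← h3, ← ofReal_norm,
    ← ENNReal.ofReal_pow (norm_nonneg _), h2, ENNReal.ofReal_sum_of_nonneg fun _ _ => by positivity]
  refine Finset.sum_congr rfl fun N _ => ?_
  rw [ENNReal.ofReal_pow (norm_nonneg _), ofReal_norm]

/-- A square-integrable function on the torus all of whose Fourier coefficients vanish is zero. -/
theorem ae_eq_zero_of_mFourierCoeff {f : UnitAddTorus d → ℂ} (hf : MemLp f 2 (torusHaar d))
    (h : ∀ N, ∫ y, mFourier (-N) y * f y ∂torusHaar d = 0) : f =ᵐ[torusHaar d] 0 := by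
  have hc : ∀ N, mFourierCoeff (hf.toLp f) N = 0 := by
    intro N
    rw [← h N]
    refine integral_congr_ae ?_
    filter_upwards [hf.coeFn_toLp] with y hy
    rw [smul_eq_mul]
    exact congrArg _ hy
  have h0 := hasSum_mFourier_series_L2 (hf.toLp f)
  simp only [hc, zero_smul] at h0
  have := h0.unique hasSum_zero
  have h1 := hf.coeFn_toLp
  rw [this] at h1
  exact h1.symm.trans (Lp.coeFn_zero _ _ _)

/-- A square-integrable function on `X × (ℝ / ℤ)^d` vanishes if it is orthogonal to the products
of indicator functions on `X` and characters of the torus. -/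
theorem ae_eq_zero_of_partial_mFourierCoeff {X : Type*} [MeasurableSpace X] {ρ : Measure X}
    [IsFiniteMeasure ρ] {F : X × UnitAddTorus d → ℂ} (hF : MemLp F 2 (ρ.prod (torusHaar d)))
    (hm : Measurable F)
    (h : ∀ (A : Set X) (N : d → ℤ), MeasurableSet A →
      ∫ p in A ×ˢ Set.univ, mFourier (-N) p.2 * F p ∂ρ.prod (torusHaar d) = 0) :
    F =ᵐ[ρ.prod (torusHaar d)] 0 := by
  have hint : ∀ N : d → ℤ,
      Integrable (fun p : X × UnitAddTorus d => mFourier (-N) p.2 * F p) (ρ.prod (torusHaar d)) := by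
    intro N
    refine (hF.integrable (by norm_num)).bdd_mul (c := 1) ?_ (.of_forall fun p => ?_)
    · exact ((mFourier (-N)).continuous.measurable.comp measurable_snd).aestronglyMeasurable
    · exact ((mFourier (-N)).norm_coe_le_norm p.2).trans mFourier_norm.le
  -- The partial Fourier coefficients are integrable functions on `X` with vanishing integrals.
  have h1 : ∀ᵐ x ∂ρ, ∀ N : d → ℤ, ∫ y, mFourier (-N) y * F (x, y) ∂torusHaar d = 0 := by
    rw [ae_all_iff]
    intro N
    refine Integrable.ae_eq_zero_of_forall_setIntegral_eq_zero (hint N).integral_prod_left ?_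
    intro A hA _
    rw [← h A N hA, setIntegral_prod _ (hint N).integrableOn]
    simp
  have h2 : ∀ᵐ x ∂ρ, MemLp (fun y => F (x, y)) 2 (torusHaar d) := by
    have := (memLp_two_iff_integrable_sq_norm hF.1).1 hF
    filter_upwards [this.prod_right_ae] with x hx
    exact (memLp_two_iff_integrable_sq_norm
      (hm.comp measurable_prodMk_left).aestronglyMeasurable).2 hx
  have h3 : MeasurableSet {p : X × UnitAddTorus d | F p = (0 : X × UnitAddTorus d → ℂ) p} :=
    measurableSet_eq_fun hm measurable_const
  refine (Measure.ae_prod_mem_iff_ae_ae_mem h3).2 ?_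
  filter_upwards [h1, h2] with x hx hx'
  exact ae_eq_zero_of_mFourierCoeff hx' hx

theorem mFourier_torusMk (N : d → ℤ) (x : d → ℝ) :
    mFourier N (torusMk x) = Circle.exp (2 * Real.pi * ∑ i, N i * x i) := by
  have h : ∀ i, fourier (N i) (torusMk x i) = (Circle.exp (2 * Real.pi * (N i * x i)) : ℂ) := by
    intro i
    rw [torusMk, fourier_coe_apply, Circle.coe_exp]
    congr 1; push_cast; ring
  change ∏ i, fourier (N i) (torusMk x i) = _
  simp only [h, Finset.mul_sum]
  rw [Circle.coe_exp]
  simp only [Circle.coe_exp]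
  rw [← Complex.exp_sum]
  push_cast
  rw [Finset.sum_mul]

theorem lintegral_torusHaar (f : UnitAddTorus d → ENNReal) :
    ∫⁻ y, f y ∂torusHaar d = ∫⁻ x in Set.univ.pi fun _ => Set.Ioc 0 1, f (torusMk x) := by
  have := lintegral_preimage f 0
  refine this.trans ?_
  congr 3
  ext x; simp

/-- Integration over `ℝ^d` is integration over the translates of the unit cube. -/
theorem lintegral_eq_tsum_torus (f : (d → ℝ) → ENNReal) :
    ∫⁻ x, f x = ∑' a : d → ℤ, ∫⁻ y, f (fun i => a i + torusRep y i) ∂torusHaar d := by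
  classical
  have h1 : ∀ a : d → ℤ, ∫⁻ y, f (fun i => a i + torusRep y i) ∂torusHaar d =
      ∫⁻ x in Set.univ.pi fun _ => Set.Ico 0 1, f (fun i => a i + x i) := by
    intro a
    rw [lintegral_torusHaar]
    -- The fundamental domain of the lattice in Mathlib is a product of intervals `[0, 1)`.
    have hae : (Set.univ.pi fun _ : d => Set.Ico (0 : ℝ) 1) =ᵐ[volume]
        Set.univ.pi fun _ : d => Set.Ioc (0 : ℝ) 1 :=
      (Measure.univ_pi_Ico_ae_eq_Icc (f := fun _ => 0) (g := fun _ => 1)).trans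
        (Measure.univ_pi_Ioc_ae_eq_Icc (f := fun _ => 0) (g := fun _ => 1)).symm
    rw [setLIntegral_congr hae]
    refine setLIntegral_congr_fun (MeasurableSet.univ_pi fun _ => measurableSet_Ioc) fun x hx => ?_
    rw [torusRep_torusMk fun i => hx i (Set.mem_univ i)]
  rw [tsum_congr h1]
  have : Countable (Submodule.span ℤ (Set.range (Pi.basisFun ℝ d))).toAddSubgroup :=
    inferInstanceAs (Countable (Submodule.span ℤ (Set.range (Pi.basisFun ℝ d))))
  have h2 := (ZSpan.isAddFundamentalDomain' (Pi.basisFun ℝ d) volume).lintegral_eq_tsum'' f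
  rw [ZSpan.fundamentalDomain_pi_basisFun] at h2
  rw [h2]
  let e : (Submodule.span ℤ (Set.range (Pi.basisFun ℝ d))).toAddSubgroup ≃ (d → ℤ) :=
    ((Pi.basisFun ℝ d).restrictScalars ℤ).equivFun.toEquiv
  rw [← e.tsum_eq]
  refine tsum_congr fun v => ?_
  have he : ∀ i, ((e v i : ℤ) : ℝ) = (v : d → ℝ) i := by
    intro i
    have := (Pi.basisFun ℝ d).restrictScalars_repr_apply ℤ v i
    simpa [e] using this
  refine lintegral_congr fun x => ?_
  congr 1
  funext i
  rw [he]
  rfl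

end Torus

/-! ### Haar measures on coset spaces -/

namespace CosetSection

variable {G : Type*} [Group G] [MeasurableSpace G] {N : Subgroup G} [N.Normal]
  {X : Type*} [MeasurableSpace X] (S : CosetSection N X)

theorem mk_sec_proj (x : G) : (S.sec (S.proj x) : G ⧸ N) = x := by
  rw [QuotientGroup.eq]
  have := ‹N.Normal›.conj_mem _ (S.mul_inv_mem x) (S.sec (S.proj x))⁻¹
  simpa [mul_assoc] using this

variable [TopologicalSpace G] [IsTopologicalGroup G] [BorelSpace (G ⧸ N)] [AddGroup X] [TopologicalSpace X]
  [T2Space X] [BorelSpace X]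

/-- If the cosets of `N` are parametrized by a topological group, compatibly with the group
structures, then a Haar measure on `G ⧸ N` is transported to a Haar measure. -/
theorem isAddHaarMeasure_map (hc : Continuous S.proj)
    (hadd : ∀ x y, S.proj (x * y) = S.proj x + S.proj y)
    (hcomp : ∀ K : Set X, IsCompact K → ∃ C : Set G, IsCompact C ∧ S.sec '' K ⊆ C)
    (ν : Measure (G ⧸ N)) [ν.IsHaarMeasure] [ContinuousAdd X] :
    (ν.map S.projQuot).IsAddHaarMeasure := by
  have hcq : Continuous S.projQuot := by
    refine (QuotientGroup.isQuotientMap_mk N).continuous_iff.2 ?_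
    have : S.projQuot ∘ QuotientGroup.mk = S.proj := funext S.projQuot_mk
    rwa [this]
  have hmul : ∀ z w, S.projQuot (z * w) = S.projQuot z + S.projQuot w := by
    intro z w
    induction z using QuotientGroup.induction_on with | _ x => ?_
    induction w using QuotientGroup.induction_on with | _ y => ?_
    rw [← QuotientGroup.mk_mul, projQuot_mk, projQuot_mk, projQuot_mk, hadd]
  have hsurj : Function.Surjective S.projQuot := fun y =>
    ⟨(S.sec y : G ⧸ N), by rw [projQuot_mk, S.proj_sec]⟩
  -- The three properties: finite on compact sets, invariant, positive on open sets.
  refine { lt_top_of_isCompact := ?_, map_add_left_eq_self := ?_, open_pos := ?_ }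
  · intro K hK
    obtain ⟨C, hC, hKC⟩ := hcomp K hK
    rw [Measure.map_apply hcq.measurable hK.measurableSet]
    refine (measure_mono ?_).trans_lt
      (hC.image QuotientGroup.continuous_mk).measure_lt_top
    intro z hz
    induction z using QuotientGroup.induction_on with | _ x => ?_
    rw [Set.mem_preimage, projQuot_mk] at hz
    exact ⟨_, hKC ⟨_, hz, rfl⟩, S.mk_sec_proj x⟩
  · intro a
    obtain ⟨z, rfl⟩ := hsurj a
    rw [Measure.map_map (measurable_const_add _) hcq.measurable]
    have : (fun x => S.projQuot z + x) ∘ S.projQuot = S.projQuot ∘ fun w => z * w := by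
      funext w; exact (hmul z w).symm
    rw [this, ← Measure.map_map hcq.measurable (measurable_const_mul z), map_mul_left_eq_self]
  · intro U hU hne
    rw [Measure.map_apply hcq.measurable hU.measurableSet]
    exact ((hU.preimage hcq).measure_pos ν (hne.preimage hsurj)).ne'

end CosetSection

/-! ### Coordinates on the Heisenberg group -/

namespace Heisenberg

variable {g h : ℕ}

/-- The entries of a matrix as a vector. -/
def entries {R : Type*} (L : Matrix (Fin h) (Fin g) R) : Fin h × Fin g → R := fun p => L p.1 p.2

/-- The matrix with given entries. -/
def mat {R : Type*} (y : Fin h × Fin g → R) : Matrix (Fin h) (Fin g) R := Matrix.of fun i j => y (i, j)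

@[simp] theorem entries_mat {R : Type*} (y : Fin h × Fin g → R) : entries (mat y) = y := rfl
@[simp] theorem mat_entries {R : Type*} (L : Matrix (Fin h) (Fin g) R) : mat (entries L) = L := rfl
@[simp] theorem mat_apply {R : Type*} (y : Fin h × Fin g → R) (i : Fin h) (j : Fin g) :
    mat y i j = y (i, j) := rfl
@[simp] theorem entries_apply {R : Type*} (L : Matrix (Fin h) (Fin g) R) (p : Fin h × Fin g) :
    entries L p = L p.1 p.2 := rfl

/-- The element `[λ, μ, 0] = (λ, μ, - μ ᵗλ)`. -/
def point (L U : Matrix (Fin h) (Fin g) ℝ) : Heisenberg g h :=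
  ⟨L, U, -(U * Lᵀ), by simp [Matrix.IsSymm]⟩

@[simp] theorem lam_point (L U : Matrix (Fin h) (Fin g) ℝ) : (point L U).lam = L := rfl
@[simp] theorem mu_point (L U : Matrix (Fin h) (Fin g) ℝ) : (point L U).mu = U := rfl
@[simp] theorem bracket_point (L U : Matrix (Fin h) (Fin g) ℝ) : (point L U).bracket = 0 := by
  simp [bracket, point]

theorem ext_bracket {x y : Heisenberg g h} (hl : x.lam = y.lam) (hm : x.mu = y.mu)
    (hb : x.bracket = y.bracket) : x = y := by
  refine Heisenberg.ext hl hm ?_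
  simpa [bracket, hl, hm] using hb

theorem continuous_entries_lam : Continuous fun x : Heisenberg g h => entries x.lam :=
  continuous_pi fun p => (continuous_lam.matrix_elem p.1 p.2)

theorem continuous_entries_mu : Continuous fun x : Heisenberg g h => entries x.mu :=
  continuous_pi fun p => (continuous_mu.matrix_elem p.1 p.2)

theorem continuous_bracket : Continuous (bracket (g := g) (h := h)) :=
  continuous_kappa.add (continuous_mu.matrix_mul continuous_lam.matrix_transpose)

theorem continuous_mat : Continuous (mat (g := g) (h := h) (R := ℝ)) :=
  continuous_matrix fun _ _ => continuous_apply _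

theorem continuous_point : Continuous fun p : (Fin h × Fin g → ℝ) × (Fin h × Fin g → ℝ) =>
    point (mat p.1) (mat p.2) := by
  have h1 := continuous_mat.comp (continuous_fst (X := Fin h × Fin g → ℝ) (Y := Fin h × Fin g → ℝ))
  have h2 := continuous_mat.comp (continuous_snd (X := Fin h × Fin g → ℝ) (Y := Fin h × Fin g → ℝ))
  exact continuous_induced_rng.2
    (h1.prodMk (h2.prodMk (h2.matrix_mul h1.matrix_transpose).neg))

variable (g h)

/-- The cosets of `K` are parametrized by `λ`. -/
def polarizationSection : CosetSection (polarizationSubgroup g h) (Fin h × Fin g → ℝ) where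
  proj x := entries x.lam
  sec y := point (mat y) 0
  measurable_proj := continuous_entries_lam.measurable
  measurable_sec :=
    (continuous_point.comp (continuous_id.prodMk (continuous_const (y := 0)))).measurable
  proj_mul n x := by
    have : n.1.lam = 0 := n.2
    simp [this]
  proj_sec y := by simp
  mul_inv_mem x := by
    show (x * _).lam = 0
    simp

/-- The cosets of `Γ_L` are parametrized by `λ` and `μ` modulo the integral matrices. -/
def latticeSection : CosetSection (latticeSubgroup g h)
    (UnitAddTorus (Fin h × Fin g) × UnitAddTorus (Fin h × Fin g)) where
  proj x := (torusMk (entries x.lam), torusMk (entries x.mu))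
  sec y := point (mat (torusRep y.1)) (mat (torusRep y.2))
  measurable_proj := (measurable_torusMk.comp continuous_entries_lam.measurable).prodMk
    (measurable_torusMk.comp continuous_entries_mu.measurable)
  measurable_sec := continuous_point.measurable.comp
    ((measurable_torusRep.comp measurable_fst).prodMk (measurable_torusRep.comp measurable_snd))
  proj_mul n x := by
    obtain ⟨n, ⟨a, ha⟩, ⟨b, hb⟩⟩ := n
    refine Prod.ext (torusMk_eq_iff.2 ⟨fun p => a p.1 p.2, fun p => ?_⟩)
      (torusMk_eq_iff.2 ⟨fun p => b p.1 p.2, fun p => ?_⟩)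
    · simp [ha, add_comm]
    · simp [hb, add_comm]
  proj_sec y := by simp [torusMk_torusRep]
  mul_inv_mem x := by
    obtain ⟨a, ha⟩ := torusMk_eq_iff.1 (torusMk_torusRep (torusMk (entries x.lam))).symm
    obtain ⟨b, hb⟩ := torusMk_eq_iff.1 (torusMk_torusRep (torusMk (entries x.mu))).symm
    refine ⟨⟨Matrix.of fun i j => a (i, j), ?_⟩, ⟨Matrix.of fun i j => b (i, j), ?_⟩⟩
    · ext i j
      have := ha (i, j)
      simp only [entries_apply] at this
      simp [this]
    · ext i j
      have := hb (i, j)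
      simp only [entries_apply] at this
      simp [this]

variable {g h}

/-- By uniqueness of Haar measures, the given measure on `K \ G` is a multiple of Lebesgue measure
in `λ`. -/
theorem exists_map_polarizationSection (ν : Measure (Heisenberg g h ⧸ polarizationSubgroup g h))
    [ν.IsHaarMeasure] : ∃ c : NNReal, c ≠ 0 ∧
      ν.map (polarizationSection g h).projQuot = c • volume := by
  have : (ν.map (polarizationSection g h).projQuot).IsAddHaarMeasure := by
    refine (polarizationSection g h).isAddHaarMeasure_map continuous_entries_lam (fun x y => rfl)
      (fun K hK => ⟨_, hK.image (continuous_point.comp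
        (continuous_id.prodMk (continuous_const (y := 0)))), subset_rfl⟩) ν
  exact ⟨_, (Measure.addHaarScalarFactor_pos_of_isAddHaarMeasure _ _).ne',
    Measure.isAddLeftInvariant_eq_smul _ _⟩

/-- By uniqueness of Haar measures, the given measure on `Γ_L \ G` is a multiple of the product of
the Haar measures of the tori of all `λ` and of all `μ`. -/
theorem exists_map_latticeSection (ν : Measure (Heisenberg g h ⧸ latticeSubgroup g h))
    [ν.IsHaarMeasure] : ∃ c : NNReal, c ≠ 0 ∧
      ν.map (latticeSection g h).projQuot =
        c • (torusHaar (Fin h × Fin g)).prod (torusHaar (Fin h × Fin g)) := by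
  have : (ν.map (latticeSection g h).projQuot).IsAddHaarMeasure := by
    refine (latticeSection g h).isAddHaarMeasure_map
      ((continuous_torusMk.comp continuous_entries_lam).prodMk
        (continuous_torusMk.comp continuous_entries_mu)) (fun x y => rfl) (fun K hK => ?_) ν
    have hI : IsCompact (Set.univ.pi fun _ : Fin h × Fin g => Set.Icc (0 : ℝ) 1) :=
      isCompact_univ_pi fun _ => isCompact_Icc
    refine ⟨_, (hI.prod hI).image continuous_point, ?_⟩
    rintro _ ⟨y, -, rfl⟩
    refine ⟨(torusRep y.1, torusRep y.2), ⟨fun i _ => ?_, fun i _ => ?_⟩, rfl⟩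
    · exact Set.Ioc_subset_Icc_self (torusRep_mem_Ioc y.1 i)
    · exact Set.Ioc_subset_Icc_self (torusRep_mem_Ioc y.2 i)
  exact ⟨_, (Measure.addHaarScalarFactor_pos_of_isAddHaarMeasure _ _).ne',
    Measure.isAddLeftInvariant_eq_smul _ _⟩

end Heisenberg

/-! ### Cosets of integral matrices -/

section Cosets

open Heisenberg

variable {g h : ℕ}

/-- The cokernel of an integral matrix of nonzero determinant has order `|det A|`. -/
theorem Matrix.card_quotient_range_mulVecLin {m : Type*} [Fintype m] [DecidableEq m]
    (A : Matrix m m ℤ) (hA : A.det ≠ 0) :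
    Nat.card ((m → ℤ) ⧸ LinearMap.range A.mulVecLin) = A.det.natAbs := by
  have hinj : Function.Injective A.mulVecLin := Matrix.mulVec_injective_of_det_ne_zero hA
  rw [← Submodule.natAbs_det_equiv _ (LinearEquiv.ofInjective A.mulVecLin hinj),
    ← LinearMap.det_toLin', Matrix.toLin'_apply']
  rfl

/-- The product of an integral matrix and a matrix given by its vector of entries. -/
def leftMul {R : Type*} [CommRing R] (A : Matrix (Fin h) (Fin h) R) (a : Fin h × Fin g → R) :
    Fin h × Fin g → R := entries (A * mat a)

/-- Column by column, the quotient of `ℤ^{h × g}` by `A ℤ^{h × g}` is a product of `g` groups of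
order `|det A|`. -/
theorem exists_coset_representatives (g : ℕ) (A : Matrix (Fin h) (Fin h) ℤ) (hA : A.det ≠ 0) :
    ∃ r : Fin (A.det.natAbs ^ g) → (Fin h × Fin g → ℤ), Function.Bijective
      fun p : Fin (A.det.natAbs ^ g) × (Fin h × Fin g → ℤ) => r p.1 + leftMul A p.2 := by
  have hinj : Function.Injective A.mulVecLin := Matrix.mulVec_injective_of_det_ne_zero hA
  have hcard := A.card_quotient_range_mulVecLin hA
  have hfin : Finite ((Fin h → ℤ) ⧸ LinearMap.range A.mulVecLin) :=
    Nat.finite_of_card_ne_zero (by simpa [hcard] using hA)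
  obtain ⟨e⟩ : Nonempty (Fin (A.det.natAbs ^ g) ≃
      (Fin g → (Fin h → ℤ) ⧸ LinearMap.range A.mulVecLin)) := by
    refine ⟨(Finite.equivFinOfCardEq ?_).symm⟩
    simp [Nat.card_pi, hcard]
  have hcol : ∀ (a : Fin h × Fin g → ℤ) (j : Fin g),
      (fun i => leftMul A a (i, j)) = A.mulVecLin fun i => a (i, j) := by
    intro a j; funext i
    simp [leftMul, Matrix.mul_apply, Matrix.mulVec, dotProduct]
  refine ⟨fun ρ p => (e ρ p.2).out p.1, ?_, ?_⟩
  · rintro ⟨ρ, a⟩ ⟨ρ', a'⟩ heq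
    have heq' : ∀ j, (e ρ j).out + A.mulVecLin (fun i => a (i, j)) =
        (e ρ' j).out + A.mulVecLin fun i => a' (i, j) := by
      intro j
      rw [← hcol, ← hcol]
      funext i
      exact congrFun heq (i, j)
    have hρ : ρ = ρ' := by
      refine e.injective (funext fun j => ?_)
      have h1 := congrArg (Submodule.Quotient.mk (p := LinearMap.range A.mulVecLin)) (heq' j)
      have h2 : ∀ v, (Submodule.Quotient.mk (A.mulVecLin v) :
          (Fin h → ℤ) ⧸ LinearMap.range A.mulVecLin) = 0 := fun v =>
        (Submodule.Quotient.mk_eq_zero _).2 ⟨v, rfl⟩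
      have h3 : ∀ z : (Fin h → ℤ) ⧸ LinearMap.range A.mulVecLin,
        Submodule.Quotient.mk z.out = z := fun z => Quotient.out_eq z
      simpa only [Submodule.Quotient.mk_add, h2, h3, add_zero] using h1
    subst hρ
    refine Prod.ext rfl (funext fun p => ?_)
    exact congrFun (hinj (add_left_cancel (heq' p.2))) p.1
  · intro N
    have : ∀ j : Fin g, ∃ v, A.mulVecLin v = (fun i => N (i, j)) -
        (Submodule.Quotient.mk (p := LinearMap.range A.mulVecLin) fun i => N (i, j)).out := by
      intro j
      have := (Submodule.Quotient.eq (LinearMap.range A.mulVecLin)).1 (Quotient.out_eq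
        (Submodule.Quotient.mk (p := LinearMap.range A.mulVecLin) fun i => N (i, j))).symm
      exact this
    choose v hv using this
    refine ⟨(e.symm fun j => Submodule.Quotient.mk fun i => N (i, j), fun p => v p.2 p.1), ?_⟩
    funext p
    have h1 := congrFun (hcol (fun p => v p.2 p.1) p.2) p.1
    have h2 := congrFun (hv p.2) p.1
    simp only [Pi.add_apply, Equiv.apply_symm_apply]
    refine (congrArg (_ + ·) (h1.trans h2)).trans ?_
    simp

end Cosets

/-! ### The theta map -/

section Theta

open Heisenberg UnitAddTorus

variable {g h : ℕ} {M : Matrix (Fin h) (Fin h) ℝ}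

theorem leftMul_add {R : Type*} [CommRing R] (A : Matrix (Fin h) (Fin h) R)
    (a b : Fin h × Fin g → R) : leftMul A (a + b) = leftMul A a + leftMul A b := by
  have : mat (a + b) = mat a + mat b := rfl
  rw [leftMul, this, Matrix.mul_add]
  rfl

/-- An equivariant function for `σ_M` is determined by its values at the points `(λ, 0, 0)`. -/
theorem IsEquivariant.eq_exp_bracket_mul {φ : Heisenberg g h → ℂ}
    (hφ : IsEquivariant (polarizationSubgroup g h) (schrodingerChar M) φ) (x : Heisenberg g h) :
    φ x = Circle.exp (2 * Real.pi * (M * x.bracket).trace) *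
      φ ((polarizationSection g h).sec (entries x.lam)) := by
  let n : polarizationSubgroup g h :=
    ⟨⟨0, x.mu, x.bracket, by
      rw [transpose_zero, Matrix.mul_zero, add_zero]; exact x.symm⟩, rfl⟩
  have hn : (n : Heisenberg g h).bracket = x.bracket := by simp [n, bracket]
  have hx : x = n * point x.lam 0 := by
    refine ext_bracket ?_ ?_ ?_
    · simp [n]
    · simp [n]
    · rw [bracket_mul, hn]; simp
  conv_lhs => rw [hx, hφ]
  rfl

variable (M) in
/-- The arithmetic data entering the theta map: the integral matrix `A = 2M`, its real inverse `B`,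
and representatives `rep` of the cosets of `A ℤ^{h × g}` in `ℤ^{h × g}`. -/
structure ThetaData (g n : ℕ) where
  A : Matrix (Fin h) (Fin h) ℤ
  B : Matrix (Fin h) (Fin h) ℝ
  two_smul_eq : (2 : ℝ) • M = A.map (Int.cast : ℤ → ℝ)
  mul_inv : A.map (Int.cast : ℤ → ℝ) * B = 1
  inv_mul : B * A.map (Int.cast : ℤ → ℝ) = 1
  rep : Fin n → (Fin h × Fin g → ℤ)
  bijective : Function.Bijective
    fun p : Fin n × (Fin h × Fin g → ℤ) => rep p.1 + leftMul A p.2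

namespace ThetaData

variable {n : ℕ} (S : ThetaData M g n)

/-- Every integral matrix is uniquely the sum of a representative and an element of
`A ℤ^{h × g}`. -/
def index : Fin n × (Fin h × Fin g → ℤ) ≃ (Fin h × Fin g → ℤ) := Equiv.ofBijective _ S.bijective

theorem index_apply (α : Fin n) (a : Fin h × Fin g → ℤ) :
    S.index (α, a) = S.rep α + leftMul S.A a := rfl

/-- The coset of an integral matrix modulo `A ℤ^{h × g}`. -/
def cls (N : Fin h × Fin g → ℤ) : Fin n := (S.index.symm N).1

theorem index_add (α : Fin n) (a b : Fin h × Fin g → ℤ) :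
    S.index (α, a) + leftMul S.A b = S.index (α, a + b) := by
  rw [index_apply, index_apply, leftMul_add, add_assoc]

theorem cls_index (p) : S.cls (S.index p) = p.1 := by simp [cls]

theorem cls_add (N b : Fin h × Fin g → ℤ) : S.cls (N + leftMul S.A b) = S.cls N := by
  obtain ⟨⟨α, a⟩, rfl⟩ := S.index.surjective N
  rw [index_add, cls_index, cls_index]

theorem exists_of_cls_eq {N N' : Fin h × Fin g → ℤ} (hN : S.cls N' = S.cls N) :
    ∃ b, N' = N + leftMul S.A b := by
  obtain ⟨⟨α, a⟩, rfl⟩ := S.index.surjective N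
  obtain ⟨⟨α', a'⟩, rfl⟩ := S.index.surjective N'
  rw [cls_index, cls_index] at hN
  simp only at hN
  subst hN
  exact ⟨a' - a, by rw [index_add]; simp⟩

/-- The vector of entries of `(2M)⁻¹ N`. -/
def shift (N : Fin h × Fin g → ℤ) : Fin h × Fin g → ℝ := leftMul S.B fun p => (N p : ℝ)

theorem leftMul_shift (N : Fin h × Fin g → ℤ) :
    leftMul (S.A.map (Int.cast : ℤ → ℝ)) (S.shift N) = fun p => (N p : ℝ) := by
  rw [leftMul, shift, leftMul, mat_entries, ← Matrix.mul_assoc, S.mul_inv, Matrix.one_mul, entries_mat]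

theorem shift_leftMul (b : Fin h × Fin g → ℤ) : S.shift (leftMul S.A b) = fun p => (b p : ℝ) := by
  have : (fun p => ((leftMul S.A b p : ℤ) : ℝ)) =
      leftMul (S.A.map (Int.cast : ℤ → ℝ)) fun p => (b p : ℝ) := by
    funext p; simp [leftMul, Matrix.mul_apply]
  rw [shift, this, leftMul, leftMul, mat_entries, ← Matrix.mul_assoc, S.inv_mul, Matrix.one_mul,
    entries_mat]

theorem shift_add (N b : Fin h × Fin g → ℤ) :
    S.shift (N + leftMul S.A b) = S.shift N + fun p => (b p : ℝ) := by
  rw [← S.shift_leftMul b]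
  conv_rhs => rw [shift, shift, ← leftMul_add]
  rw [shift]
  congr 1; funext p; simp

/-- The lattice `(2M)⁻¹ ℤ^{h × g}` has finitely many points in every bounded set. -/
theorem finite_shift (C : Fin h × Fin g → ℝ) :
    {N : Fin h × Fin g → ℤ | ∀ p, |S.shift N p| ≤ C p}.Finite := by
  let c : Fin h × Fin g → ℤ := fun p => ⌈∑ k, |(S.A p.1 k : ℝ)| * C (k, p.2)⌉
  refine (Set.finite_Icc (-c) c).subset fun N hN => ?_
  have key : ∀ p, |N p| ≤ c p := by
    intro p
    have h1 : (N p : ℝ) = ∑ k, (S.A p.1 k : ℝ) * S.shift N (k, p.2) := by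
      rw [← congrFun (S.leftMul_shift N) p]
      simp [leftMul, Matrix.mul_apply]
    have h2 : |(N p : ℝ)| ≤ ∑ k, |(S.A p.1 k : ℝ)| * C (k, p.2) := by
      rw [h1]
      refine (Finset.abs_sum_le_sum_abs _ _).trans (Finset.sum_le_sum fun k _ => ?_)
      rw [abs_mul]
      exact mul_le_mul_of_nonneg_left (hN _) (abs_nonneg _)
    have h3 := h2.trans (Int.le_ceil _)
    rw [← Int.cast_abs] at h3
    exact Int.cast_le.1 h3
  exact ⟨fun p => (abs_le.1 (key p)).1, fun p => (abs_le.1 (key p)).2⟩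

/-- The element `((2M)⁻¹ N, 0, 0)`. -/
def shiftPoint (N : Fin h × Fin g → ℤ) : Heisenberg g h := point (mat (S.shift N)) 0

theorem trace_mul_add_transpose (M : Matrix (Fin h) (Fin h) ℝ) (hM : M.IsSymm)
    (X : Matrix (Fin h) (Fin h) ℝ) : (M * (X + Xᵀ)).trace = (((2 : ℝ) • M) * X).trace := by
  have h1 : (M * Xᵀ).trace = (M * X).trace := by
    rw [← trace_transpose, transpose_mul, transpose_transpose, hM.eq, trace_mul_comm]
  rw [Matrix.mul_add, trace_add, h1, Matrix.smul_mul, trace_smul, smul_eq_mul, two_mul]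

theorem trace_two_smul_mul (L U : Matrix (Fin h) (Fin g) ℝ) (hM : M.IsSymm) :
    (M * (L * Uᵀ + (L * Uᵀ)ᵀ)).trace =
      ∑ p, leftMul (S.A.map (Int.cast : ℤ → ℝ)) (entries L) p * entries U p := by
  rw [trace_mul_add_transpose M hM, S.two_smul_eq, ← Matrix.mul_assoc, Fintype.sum_prod_type]
  simp [trace, leftMul, Matrix.mul_apply (N := Uᵀ)]

theorem trace_bracket_shiftPoint_mul (hM : M.IsSymm) (N : Fin h × Fin g → ℤ)
    (x : Heisenberg g h) : (M * (S.shiftPoint N * x).bracket).trace =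
      (M * x.bracket).trace + ∑ p, N p * entries x.mu p := by
  rw [bracket_mul, shiftPoint, bracket_point, zero_add, Matrix.mul_add, trace_add, lam_point,
    S.trace_two_smul_mul _ _ hM, entries_mat, S.leftMul_shift]

/-- The summands of the theta map in coordinates. -/
theorem apply_shiftPoint_mul (hM : M.IsSymm) {φ : Heisenberg g h → ℂ}
    (hφ : IsEquivariant (polarizationSubgroup g h) (schrodingerChar M) φ)
    (N : Fin h × Fin g → ℤ) (x : Heisenberg g h) : φ (S.shiftPoint N * x) =
      Circle.exp (2 * Real.pi * ((M * x.bracket).trace + ∑ p, N p * entries x.mu p)) *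
        φ ((polarizationSection g h).sec (S.shift N + entries x.lam)) := by
  rw [hφ.eq_exp_bracket_mul, S.trace_bracket_shiftPoint_mul hM]
  rfl

/-- The translation law behind the `Γ_L`-equivariance of the theta map. -/
theorem apply_shiftPoint_mul_mul (hM : IsHalfIntegral M) {φ : Heisenberg g h → ℂ}
    (hφ : IsEquivariant (polarizationSubgroup g h) (schrodingerChar M) φ)
    (N b : Fin h × Fin g → ℤ) (γ : latticeSubgroup g h)
    (hb : ∀ p, entries (γ : Heisenberg g h).lam p = b p) (x : Heisenberg g h) :
    φ (S.shiftPoint N * (γ * x)) =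
      latticeChar M hM γ * φ (S.shiftPoint (N + leftMul S.A b) * x) := by
  obtain ⟨m, hm⟩ := γ.2.2
  have hb' : entries (γ : Heisenberg g h).lam = fun p => (b p : ℝ) := funext hb
  -- Since `N` and `μ(γ)` are integral, `e(N · μ(γ)) = 1`.
  have hint : (Circle.exp (2 * Real.pi * ∑ p, N p * entries (γ : Heisenberg g h).mu p)) = 1 := by
    have : ∑ p, (N p : ℝ) * entries (γ : Heisenberg g h).mu p =
        ((∑ p, N p * entries m p : ℤ) : ℝ) := by
      push_cast; simp [hm]
    rw [this, mul_comm]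
    exact Circle.exp_int_mul_two_pi _
  rw [S.apply_shiftPoint_mul hM.isSymm hφ, S.apply_shiftPoint_mul hM.isSymm hφ, ← mul_assoc]
  congr 1
  · have h1 : latticeChar M hM γ =
      Circle.exp (2 * Real.pi * (M * (γ : Heisenberg g h).bracket).trace) := rfl
    rw [h1, ← Circle.coe_mul, ← Circle.exp_add, ← mul_add, bracket_mul, Matrix.mul_add,
      Matrix.mul_add, trace_add, trace_add, S.trace_two_smul_mul _ _ hM.isSymm, hb']
    have h2 : ∀ p, leftMul (S.A.map (Int.cast : ℤ → ℝ)) (fun p => (b p : ℝ)) p =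
        ((leftMul S.A b p : ℤ) : ℝ) := by
      intro p; simp [leftMul, Matrix.mul_apply]
    have h3 : ∑ p, (N p : ℝ) * entries ((γ : Heisenberg g h) * x).mu p =
        ∑ p, N p * entries (γ : Heisenberg g h).mu p + ∑ p, N p * entries x.mu p := by
      rw [← Finset.sum_add_distrib]
      refine Finset.sum_congr rfl fun p _ => ?_
      simp [mul_add]
    have h4 : ∑ p, (((N + leftMul S.A b) p : ℤ) : ℝ) * entries x.mu p =
        ∑ p, N p * entries x.mu p + ∑ p, ((leftMul S.A b p : ℤ) : ℝ) * entries x.mu p := by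
      rw [← Finset.sum_add_distrib]
      refine Finset.sum_congr rfl fun p _ => ?_
      simp [add_mul]
    simp only [h2]
    rw [h3, h4]
    set u := ∑ p, N p * entries (γ : Heisenberg g h).mu p
    set a := (M * (γ : Heisenberg g h).bracket).trace
    set a' := (M * x.bracket).trace
    set w := ∑ p, N p * entries x.mu p
    set w' := ∑ p, ((leftMul S.A b p : ℤ) : ℝ) * entries x.mu p
    have : 2 * Real.pi * (a + a' + w' + (u + w)) =
        2 * Real.pi * u + 2 * Real.pi * (a + (a' + (w + w'))) := by ring
    rw [this, Circle.exp_add, hint, one_mul]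
  · congr 2
    rw [S.shift_add, add_assoc]
    congr 1
    rw [← hb']
    rfl

end ThetaData

end Theta

section ThetaMap

open Heisenberg UnitAddTorus

variable {g h : ℕ} {M : Matrix (Fin h) (Fin h) ℝ} {n : ℕ}

/-- A family of functions on the Heisenberg group whose supports are bounded in the direction
of `λ`. -/
def HasBoundedSupport (φ : Fin n → Heisenberg g h → ℂ) : Prop :=
  ∃ R : ℝ, ∀ α x, φ α x ≠ 0 → ∀ p, |entries x.lam p| ≤ R

namespace ThetaData

variable (S : ThetaData M g n)

/-- The theta map, `(θ φ)(x) = ∑_N φ_{[N]}(((2M)⁻¹ N, 0, 0) x)`, where `N` runs over the integral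
matrices and `[N]` is the coset of `N` modulo `2M ℤ^{h × g}`. -/
def theta (φ : Fin n → Heisenberg g h → ℂ) (x : Heisenberg g h) : ℂ :=
  ∑' N, φ (S.cls N) (S.shiftPoint N * x)

/-- The sum defining the theta map is finite at every point. -/
theorem hasFiniteSupport_theta {φ : Fin n → Heisenberg g h → ℂ} (hφ : HasBoundedSupport φ)
    (x : Heisenberg g h) :
    (Function.support fun N => φ (S.cls N) (S.shiftPoint N * x)).Finite := by
  obtain ⟨R, hR⟩ := hφ
  refine (S.finite_shift fun p => R + |entries x.lam p|).subset fun N hN p => ?_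
  have h1 := hR _ _ hN p
  have h2 : entries (S.shiftPoint N * x).lam p = S.shift N p + entries x.lam p := rfl
  rw [h2] at h1
  have h3 := abs_sub (S.shift N p + entries x.lam p) (entries x.lam p)
  rw [add_sub_cancel_right] at h3
  linarith

theorem hasSum_theta {φ : Fin n → Heisenberg g h → ℂ} (hφ : HasBoundedSupport φ)
    (x : Heisenberg g h) :
    HasSum (fun N => φ (S.cls N) (S.shiftPoint N * x)) (S.theta φ x) :=
  (summable_of_hasFiniteSupport (S.hasFiniteSupport_theta hφ x)).hasSum

theorem measurable_theta {φ : Fin n → Heisenberg g h → ℂ} (hφ : HasBoundedSupport φ)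
    (hm : ∀ α, Measurable (φ α)) : Measurable (S.theta φ) := by
  refine measurable_of_tendsto_metrizable' Filter.atTop
    (f := fun (s : Finset (Fin h × Fin g → ℤ)) x => ∑ N ∈ s, φ (S.cls N) (S.shiftPoint N * x))
    (fun s => ?_) (tendsto_pi_nhds.2 fun x => S.hasSum_theta hφ x)
  exact Finset.measurable_fun_sum _ fun N _ => (hm _).comp (measurable_const_mul _)

/-- Left multiplication by an element of `Γ_L` with `λ = b` permutes the summands of the theta map
by `N ↦ N + 2M b`. -/
theorem isEquivariant_theta (hM : IsHalfIntegral M) {φ : Fin n → Heisenberg g h → ℂ}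
    (hφ : ∀ α, IsEquivariant (polarizationSubgroup g h) (schrodingerChar M) (φ α)) :
    IsEquivariant (latticeSubgroup g h) (latticeChar M hM) (S.theta φ) := by
  intro γ x
  obtain ⟨a, ha⟩ := γ.2.1
  let b : Fin h × Fin g → ℤ := fun p => a p.1 p.2
  have hb : ∀ p, entries (γ : Heisenberg g h).lam p = b p := fun p => by simp [ha, b]
  rw [theta, theta, ← tsum_mul_left]
  refine (tsum_congr fun N => ?_).trans ((Equiv.addRight (leftMul S.A b)).tsum_eq fun N =>
    (latticeChar M hM γ : ℂ) * φ (S.cls N) (S.shiftPoint N * x))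
  rw [S.apply_shiftPoint_mul_mul hM (hφ _) N b γ hb, Equiv.coe_addRight, S.cls_add]

/-- On representatives of the cosets of `Γ_L`, the theta map is a Fourier series in `μ`. -/
theorem theta_sec (hM : M.IsSymm) {φ : Fin n → Heisenberg g h → ℂ}
    (hφ : ∀ α, IsEquivariant (polarizationSubgroup g h) (schrodingerChar M) (φ α))
    (y : UnitAddTorus (Fin h × Fin g) × UnitAddTorus (Fin h × Fin g)) :
    S.theta φ ((latticeSection g h).sec y) = ∑' N,
      φ (S.cls N) ((polarizationSection g h).sec (S.shift N + torusRep y.1)) * mFourier N y.2 := by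
  refine tsum_congr fun N => ?_
  have h1 : ((latticeSection g h).sec y).bracket = 0 := bracket_point _ _
  have h2 : entries ((latticeSection g h).sec y).mu = torusRep y.2 := rfl
  have h3 : entries ((latticeSection g h).sec y).lam = torusRep y.1 := rfl
  rw [S.apply_shiftPoint_mul hM (hφ _), h1, h2, h3, Matrix.mul_zero, trace_zero, zero_add,
    ← mFourier_torusMk, torusMk_torusRep, mul_comm]

theorem measurable_sec_comp {φ : Heisenberg g h → ℂ} (hm : Measurable φ)
    (v : Fin h × Fin g → ℝ) :
    Measurable fun y => ‖φ ((polarizationSection g h).sec (v + y))‖ₑ ^ 2 :=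
  ((hm.comp (polarizationSection g h).measurable_sec).comp
    (measurable_const_add v)).enorm.pow_const 2

/-- The theta map is isometric: the characters `e(N · μ)` are orthonormal, and the translates of
the unit cube by integral matrices tile the space of all `λ`. -/
theorem lintegral_theta (hM : M.IsSymm) {φ : Fin n → Heisenberg g h → ℂ}
    (hb : HasBoundedSupport φ) (hm : ∀ α, Measurable (φ α))
    (hφ : ∀ α, IsEquivariant (polarizationSubgroup g h) (schrodingerChar M) (φ α)) :
    ∫⁻ y, ‖S.theta φ ((latticeSection g h).sec y)‖ₑ ^ 2
        ∂(torusHaar (Fin h × Fin g)).prod (torusHaar (Fin h × Fin g)) =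
      ∑ α, ∫⁻ x, ‖φ α ((polarizationSection g h).sec x)‖ₑ ^ 2 := by
  set f : Fin n → (Fin h × Fin g → ℝ) → ℂ := fun α x => φ α ((polarizationSection g h).sec x)
    with hf
  have hfm : ∀ α v, Measurable fun y => ‖f α (v + y)‖ₑ ^ 2 := fun α v =>
    measurable_sec_comp (hm α) v
  have hmeas : Measurable fun y => ‖S.theta φ ((latticeSection g h).sec y)‖ₑ ^ 2 :=
    (((S.measurable_theta hb hm).comp (latticeSection g h).measurable_sec).enorm.pow_const 2)
  rw [lintegral_prod _ hmeas.aemeasurable]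
  -- Parseval's identity in `μ`, for fixed `λ`.
  have h1 : ∀ y₁ : UnitAddTorus (Fin h × Fin g),
      ∫⁻ y₂, ‖S.theta φ ((latticeSection g h).sec (y₁, y₂))‖ₑ ^ 2 ∂torusHaar (Fin h × Fin g) =
        ∑' N, ‖f (S.cls N) (S.shift N + torusRep y₁)‖ₑ ^ 2 := by
    intro y₁
    have hfin : (Function.support fun N => f (S.cls N) (S.shift N + torusRep y₁)).Finite := by
      refine (S.hasFiniteSupport_theta hb ((polarizationSection g h).sec (torusRep y₁))).subset ?_
      intro N hN
      have h0 : S.shiftPoint N * (polarizationSection g h).sec (torusRep y₁) =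
          (polarizationSection g h).sec (S.shift N + torusRep y₁) := by
        refine ext_bracket rfl ?_ ?_
        · simp [shiftPoint, polarizationSection]
        · rw [bracket_mul]; simp [shiftPoint, polarizationSection]
      rw [Function.mem_support, h0]
      exact hN
    rw [tsum_eq_sum (s := hfin.toFinset) (by
      intro N hN
      have : f (S.cls N) (S.shift N + torusRep y₁) = 0 := by simpa using hN
      simp [this])]
    rw [← lintegral_norm_sq_trigPolynomial]
    refine lintegral_congr fun y₂ => ?_
    rw [S.theta_sec hM hφ, tsum_eq_sum (s := hfin.toFinset)]
    intro N hN
    have : f (S.cls N) (S.shift N + torusRep y₁) = 0 := by simpa using hN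
    exact mul_eq_zero_of_left this _
  simp only [h1]
  rw [lintegral_tsum (f := fun N y => ‖f (S.cls N) (S.shift N + torusRep y)‖ₑ ^ 2)
      fun N => ((hfm _ _).comp measurable_torusRep).aemeasurable,
    ← S.index.tsum_eq]
  -- The indices in one coset differ by `2M a`, which amounts to an integral translation of `λ`.
  have h2 : ∀ c y, f (S.cls (S.index c)) (S.shift (S.index c) + torusRep y) =
      f c.1 (S.shift (S.rep c.1) + fun i => c.2 i + torusRep y i) := by
    rintro ⟨α, a⟩ y
    rw [S.cls_index, S.index_apply, S.shift_add, add_assoc]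
    rfl
  simp only [h2]
  rw [ENNReal.tsum_prod (f := fun α (a : Fin h × Fin g → ℤ) =>
    ∫⁻ y : UnitAddTorus (Fin h × Fin g),
      ‖f α (S.shift (S.rep α) + fun i => (a i : ℝ) + torusRep y i)‖ₑ ^ 2 ∂torusHaar _),
    tsum_fintype]
  refine Finset.sum_congr rfl fun α _ => ?_
  rw [← lintegral_eq_tsum_torus fun x => ‖f α (S.shift (S.rep α) + x)‖ₑ ^ 2,
    lintegral_add_left_eq_self (fun x => ‖f α x‖ₑ ^ 2)]

/-- The theta map produces products of arbitrary functions of `λ` modulo integral matrices with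
characters in `μ`. -/
theorem theta_sec_of_support (hM : M.IsSymm) (N : Fin h × Fin g → ℤ)
    {φ : Fin n → Heisenberg g h → ℂ}
    (hφ : ∀ α, IsEquivariant (polarizationSubgroup g h) (schrodingerChar M) (φ α))
    (h0 : ∀ α, α ≠ S.cls N → φ α = 0)
    (h1 : ∀ x, φ (S.cls N) ((polarizationSection g h).sec (S.shift N + x)) ≠ 0 →
      ∀ i, x i ∈ Set.Ioc (0 : ℝ) 1)
    (y : UnitAddTorus (Fin h × Fin g) × UnitAddTorus (Fin h × Fin g)) :
    S.theta φ ((latticeSection g h).sec y) =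
      φ (S.cls N) ((polarizationSection g h).sec (S.shift N + torusRep y.1)) * mFourier N y.2 := by
  rw [S.theta_sec hM hφ]
  refine tsum_eq_single N fun N' hN' => ?_
  refine mul_eq_zero_of_left ?_ _
  by_cases hc : S.cls N' = S.cls N
  · obtain ⟨b, rfl⟩ := S.exists_of_cls_eq hc
    rw [S.cls_add, S.shift_add, add_assoc]
    by_contra hne
    refine hN' ?_
    -- Two points of `(0, 1]` which differ by an integer are equal.
    have hb : b = 0 := by
      funext i
      have hi := h1 _ hne i
      have hr := torusRep_mem_Ioc y.1 i
      have hi1 : (0 : ℝ) < b i + torusRep y.1 i := hi.1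
      have hi2 : (b i : ℝ) + torusRep y.1 i ≤ 1 := hi.2
      have hr1 : (0 : ℝ) < torusRep y.1 i := hr.1
      have hr2 : torusRep y.1 i ≤ 1 := hr.2
      have hlt : (b i : ℝ) < 1 := by linarith
      have hgt : (-1 : ℝ) < b i := by linarith
      have hlt' : b i < 1 := by exact_mod_cast hlt
      have hgt' : -1 < b i := by exact_mod_cast hgt
      simp only [Pi.zero_apply]
      omega
    have : leftMul S.A (0 : Fin h × Fin g → ℤ) = 0 := by
      have : leftMul S.A (0 + 0 : Fin h × Fin g → ℤ) = _ := leftMul_add S.A 0 0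
      simpa using this
    rw [hb, this, add_zero]
  · rw [h0 _ hc]; rfl

end ThetaData

end ThetaMap

/-! ### Extension to the Hilbert spaces -/

section Extension

/-- An isometry between dense subspaces which intertwines two representations extends to a unitary
equivalence. -/
theorem unitarilyEquivalentToCopies_of_dense {G V W D : Type*} [Group G]
    [NormedAddCommGroup V] [InnerProductSpace ℂ V] [CompleteSpace V]
    [NormedAddCommGroup W] [InnerProductSpace ℂ W] [CompleteSpace W]
    [AddCommGroup D] [Module ℂ D] {π : G →* (V ≃ₗᵢ[ℂ] V)} {U : G →* (W ≃ₗᵢ[ℂ] W)} {n : ℕ}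
    (e₁ : D →ₗ[ℂ] V) (e₂ : D →ₗ[ℂ] PiLp 2 fun _ : Fin n => W)
    (h₁ : DenseRange e₁) (h₂ : DenseRange e₂) (hnorm : ∀ d, ‖e₂ d‖ = ‖e₁ d‖)
    (hact : ∀ x d, ∃ d', e₁ d' = π x (e₁ d) ∧ ∀ i, e₂ d' i = U x (e₂ d i)) :
    UnitarilyEquivalentToCopies π U n := by
  let T := (LinearEquiv.refl ℂ D).extendOfIsometry e₁ e₂ h₁ h₂ hnorm
  have hT : ∀ d, T (e₁ d) = e₂ d := fun d =>
    LinearEquiv.extendOfIsometry_eq (LinearEquiv.refl ℂ D) e₁ e₂ h₁ h₂ hnorm d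
  refine ⟨T, fun x v i => ?_⟩
  induction v using h₁.induction_on with
  | hp =>
    have hc : Continuous fun w : PiLp 2 fun _ : Fin n => W => w i := PiLp.continuous_apply 2 _ i
    exact isClosed_eq (hc.comp (T.continuous.comp (π x).continuous))
      ((U x).continuous.comp (hc.comp T.continuous))
  | ih d =>
    obtain ⟨d', h1, h2⟩ := hact x d
    rw [← h1, hT, hT, h2]

end Extension

section Truncation

open Heisenberg

variable {g h : ℕ} {M : Matrix (Fin h) (Fin h) ℝ} {n : ℕ}
  {ν' : Measure (Heisenberg g h ⧸ polarizationSubgroup g h)}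

variable (M ν' n) in
/-- Families of functions in the space of the Schrödinger representation with bounded support. -/
def boundedFunctions :
    Submodule ℂ (Fin n → PreInduced (polarizationSubgroup g h) (schrodingerChar M) ν') where
  carrier := {φ | HasBoundedSupport fun α => (φ α).fn}
  zero_mem' := ⟨0, fun α x hx => (hx rfl).elim⟩
  add_mem' := by
    rintro φ ψ ⟨R, hR⟩ ⟨R', hR'⟩
    refine ⟨max R R', fun α x hx p => ?_⟩
    by_cases hφ : (φ α).fn x = 0
    · refine (hR' α x (fun hψ => hx ?_) p).trans (le_max_right _ _)
      simp [hφ, hψ]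
    · exact (hR α x hφ p).trans (le_max_left _ _)
  smul_mem' := by
    rintro c φ ⟨R, hR⟩
    refine ⟨R, fun α x hx => hR α x fun h0 => hx ?_⟩
    simp [h0]

theorem hasBoundedSupport_translate {φ : Fin n → Heisenberg g h → ℂ} (hφ : HasBoundedSupport φ)
    (x₀ : Heisenberg g h) : HasBoundedSupport fun α x => φ α (x * x₀) := by
  obtain ⟨R, hR⟩ := hφ
  refine ⟨R + ∑ p, |entries x₀.lam p|, fun α x hx p => ?_⟩
  have h1 := hR α _ hx p
  have h2 : entries (x * x₀).lam p = entries x.lam p + entries x₀.lam p := rfl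
  have h3 := abs_sub (entries (x * x₀).lam p) (entries x₀.lam p)
  have h4 : |entries x₀.lam p| ≤ ∑ p, |entries x₀.lam p| :=
    Finset.single_le_sum (f := fun p => |entries x₀.lam p|) (fun _ _ => abs_nonneg _)
      (Finset.mem_univ p)
  rw [h2, add_sub_cancel_right] at h3
  rw [h2] at h1
  linarith

/-- Restriction of a function to the part of the group where the entries of `λ` are bounded
by `R`. -/
def truncateFn (φ : Heisenberg g h → ℂ) (R : ℕ) : Heisenberg g h → ℂ :=
  Set.indicator {x : Heisenberg g h | ∀ p, |entries x.lam p| ≤ (R : ℝ)} φ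

theorem truncateFn_of_le {φ : Heisenberg g h → ℂ} {R : ℕ} {x : Heisenberg g h}
    (hx : ∀ p, |entries x.lam p| ≤ (R : ℝ)) : truncateFn φ R x = φ x :=
  Set.indicator_of_mem (s := {x : Heisenberg g h | ∀ p, |entries x.lam p| ≤ (R : ℝ)}) hx φ

theorem truncateFn_of_not_le {φ : Heisenberg g h → ℂ} {R : ℕ} {x : Heisenberg g h}
    (hx : ¬∀ p, |entries x.lam p| ≤ (R : ℝ)) : truncateFn φ R x = 0 :=
  Set.indicator_of_notMem (s := {x : Heisenberg g h | ∀ p, |entries x.lam p| ≤ (R : ℝ)}) hx φ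

theorem enorm_truncateFn_le (φ : Heisenberg g h → ℂ) (R : ℕ) (x : Heisenberg g h) :
    ‖truncateFn φ R x‖ₑ ≤ ‖φ x‖ₑ := enorm_indicator_le_enorm_self _ _

/-- Truncation of an element of the space of the Schrödinger representation. -/
def truncate (φ : PreInduced (polarizationSubgroup g h) (schrodingerChar M) ν') (R : ℕ) :
    PreInduced (polarizationSubgroup g h) (schrodingerChar M) ν' :=
  ⟨truncateFn φ.fn R, by
    refine φ.2.1.indicator ?_
    have : {x : Heisenberg g h | ∀ p, |entries x.lam p| ≤ (R : ℝ)} =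
        ⋂ p, {x | |entries x.lam p| ≤ (R : ℝ)} := by ext; simp
    rw [this]
    exact MeasurableSet.iInter fun p => measurableSet_le
      (((continuous_apply p).comp continuous_entries_lam).abs.measurable) measurable_const, by
    intro k x
    have hk : (k : Heisenberg g h).lam = 0 := k.2
    have hiff : (∀ p, |entries ((k : Heisenberg g h) * x).lam p| ≤ (R : ℝ)) ↔
        ∀ p, |entries x.lam p| ≤ (R : ℝ) := by
      simp [hk]
    by_cases hx : ∀ p, |entries x.lam p| ≤ (R : ℝ)
    · rw [truncateFn_of_le (hiff.2 hx), truncateFn_of_le hx]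
      exact φ.2.2.1 k x
    · rw [truncateFn_of_not_le fun h => hx (hiff.1 h), truncateFn_of_not_le hx, mul_zero],
    (lintegral_mono fun z => by gcongr; exact enorm_truncateFn_le _ _ _).trans_lt φ.2.2.2⟩

theorem tendsto_truncate (φ : PreInduced (polarizationSubgroup g h) (schrodingerChar M) ν') :
    Filter.Tendsto (truncate φ) Filter.atTop (nhds φ) := by
  rw [tendsto_iff_norm_sub_tendsto_zero]
  have h1 : ∀ R, ‖truncate φ R - φ‖ =
      √(∫⁻ z : Heisenberg g h ⧸ polarizationSubgroup g h,
        ‖truncateFn φ.fn R z.out - φ.fn z.out‖ₑ ^ 2 ∂ν').toReal := by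
    intro R
    rw [eq_comm, Real.sqrt_eq_iff_mul_self_eq ENNReal.toReal_nonneg (norm_nonneg _), ← sq,
      preInduced_norm_sq]
    rfl
  simp only [h1]
  rw [← Real.sqrt_zero, ← ENNReal.toReal_zero]
  refine (Real.continuous_sqrt.tendsto _).comp ((ENNReal.tendsto_toReal ENNReal.zero_ne_top).comp ?_)
  rw [← lintegral_zero (μ := ν')]
  refine tendsto_lintegral_of_dominated_convergence
    (fun z : Heisenberg g h ⧸ polarizationSubgroup g h => ‖φ.fn z.out‖ₑ ^ 2) ?_ ?_ φ.2.2.2.ne ?_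
  · intro R
    exact ((truncate φ R - φ).2.2.1.measurable_enorm_out (truncate φ R - φ).2.1).pow_const 2
  · intro R
    refine .of_forall fun z => ?_
    simp only
    gcongr
    by_cases hz : ∀ p, |entries z.out.lam p| ≤ (R : ℝ)
    · rw [truncateFn_of_le hz, sub_self, enorm_zero]
      exact zero_le
    · rw [truncateFn_of_not_le hz, zero_sub, enorm_neg]
  · refine .of_forall fun z => ?_
    refine tendsto_const_nhds.congr' ?_
    obtain ⟨R₀, hR₀⟩ := exists_nat_ge (∑ p, |entries z.out.lam p|)
    filter_upwards [Filter.eventually_ge_atTop R₀] with R hR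
    have hz : ∀ p, |entries z.out.lam p| ≤ (R : ℝ) := by
      intro p
      have h4 : |entries z.out.lam p| ≤ ∑ p, |entries z.out.lam p| :=
        Finset.single_le_sum (f := fun p => |entries z.out.lam p|) (fun _ _ => abs_nonneg _)
          (Finset.mem_univ p)
      exact h4.trans (hR₀.trans (by exact_mod_cast hR))
    rw [truncateFn_of_le hz]
    simp

theorem truncate_mem_boundedFunctions
    (φ : Fin n → PreInduced (polarizationSubgroup g h) (schrodingerChar M) ν') (R : ℕ) :
    (fun α => truncate (φ α) R) ∈ boundedFunctions M n ν' := by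
  refine ⟨R, fun α x hx p => ?_⟩
  exact Set.mem_of_indicator_ne_zero hx p

variable (M n ν') in
/-- The inclusion of the functions of bounded support in the direct sum of copies of the
Schrödinger representation. -/
def boundedFunctionsInclusion : boundedFunctions M n ν' →ₗ[ℂ]
    PiLp 2 fun _ : Fin n => InducedSpace (polarizationSubgroup g h) (schrodingerChar M) ν' where
  toFun φ := WithLp.toLp 2 fun α => SeparationQuotient.mk (φ.1 α)
  map_add' _ _ := rfl
  map_smul' _ _ := rfl

theorem boundedFunctionsInclusion_apply (φ : boundedFunctions M n ν') (α : Fin n) :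
    boundedFunctionsInclusion M n ν' φ α = SeparationQuotient.mk (φ.1 α) := rfl

theorem denseRange_boundedFunctionsInclusion : DenseRange (boundedFunctionsInclusion M n ν') := by
  intro v
  choose φ hφ using fun α => SeparationQuotient.surjective_mk (v α)
  have hv : v = WithLp.toLp 2 fun α => SeparationQuotient.mk (φ α) := by
    ext α; exact (hφ α).symm
  rw [hv]
  refine mem_closure_of_tendsto (b := Filter.atTop) (f := fun R : ℕ =>
    boundedFunctionsInclusion M n ν' ⟨_, truncate_mem_boundedFunctions φ R⟩) ?_
    (.of_forall fun R => ⟨_, rfl⟩)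
  refine ((PiLp.continuous_toLp 2 _).tendsto _).comp (tendsto_pi_nhds.2 fun α => ?_)
  exact (SeparationQuotient.continuous_mk.tendsto _).comp (tendsto_truncate (φ α))

theorem measurable_schrodingerChar :
    Measurable fun x : polarizationSubgroup g h => (schrodingerChar M x : ℂ) := by
  have h1 : Continuous fun x : polarizationSubgroup g h =>
      2 * Real.pi * (M * x.1.kappa).trace :=
    continuous_const.mul
      (continuous_const.matrix_mul (continuous_kappa.comp continuous_subtype_val)).matrix_trace
  exact (continuous_subtype_val.comp (Circle.exp.continuous.comp h1)).measurable

theorem measurable_latticeChar (hM : IsHalfIntegral M) :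
    Measurable fun x : latticeSubgroup g h => (latticeChar M hM x : ℂ) := by
  have h1 : Continuous fun x : latticeSubgroup g h => 2 * Real.pi * (M * x.1.bracket).trace :=
    continuous_const.mul
      (continuous_const.matrix_mul (continuous_bracket.comp continuous_subtype_val)).matrix_trace
  exact (continuous_subtype_val.comp (Circle.exp.continuous.comp h1)).measurable

theorem lintegral_sec_lt_top {c : NNReal} (hc0 : c ≠ 0)
    (hc : ν'.map (polarizationSection g h).projQuot = c • volume)
    (φ : PreInduced (polarizationSubgroup g h) (schrodingerChar M) ν') :
    ∫⁻ x, ‖φ.fn ((polarizationSection g h).sec x)‖ₑ ^ 2 < ⊤ := by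
  have h1 := φ.lintegral_lt_top
  rw [(polarizationSection g h).lintegral_eq φ.isEquivariant_fn φ.measurable_fn, hc, lintegral_smul_measure] at h1
  exact ENNReal.lt_top_of_mul_ne_top_right (a := (c : ENNReal)) h1.ne (by simpa using hc0)

theorem norm_sq_boundedFunctionsInclusion {c : NNReal} (hc0 : c ≠ 0)
    (hc : ν'.map (polarizationSection g h).projQuot = c • volume) (φ : boundedFunctions M n ν') :
    ‖boundedFunctionsInclusion M n ν' φ‖ ^ 2 =
      c * (∑ α, ∫⁻ x, ‖(φ.1 α).fn ((polarizationSection g h).sec x)‖ₑ ^ 2).toReal := by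
  rw [PiLp.norm_sq_eq_of_L2, ENNReal.toReal_sum fun α _ => (lintegral_sec_lt_top hc0 hc _).ne,
    Finset.mul_sum]
  refine Finset.sum_congr rfl fun α _ => ?_
  rw [boundedFunctionsInclusion_apply, SeparationQuotient.norm_mk,
    (polarizationSection g h).norm_sq_eq, hc, lintegral_smul_measure]
  simp [ENNReal.smul_def]

end Truncation

/-! ### The theta map on Hilbert spaces -/

namespace ThetaData

open Heisenberg UnitAddTorus

variable {g h : ℕ} {M : Matrix (Fin h) (Fin h) ℝ} {n : ℕ}
  {ν : Measure (Heisenberg g h ⧸ latticeSubgroup g h)}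
  {ν' : Measure (Heisenberg g h ⧸ polarizationSubgroup g h)}
  (S : ThetaData M g n) (hM : IsHalfIntegral M) {c c' : NNReal} (hc0' : c' ≠ 0)
  (hc : ν.map (latticeSection g h).projQuot =
    c • (torusHaar (Fin h × Fin g)).prod (torusHaar (Fin h × Fin g)))
  (hc' : ν'.map (polarizationSection g h).projQuot = c' • volume)

variable (ν) in
/-- The theta map as a map into the space of the lattice representation. -/
def thetaMap (hM : IsHalfIntegral M) (hc0' : c' ≠ 0)
    (hc : ν.map (latticeSection g h).projQuot =
      c • (torusHaar (Fin h × Fin g)).prod (torusHaar (Fin h × Fin g)))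
    (hc' : ν'.map (polarizationSection g h).projQuot = c' • volume) : boundedFunctions M n ν' →ₗ[ℂ]
    PreInduced (latticeSubgroup g h) (latticeChar M hM) ν where
  toFun φ := ⟨S.theta fun α => (φ.1 α).fn, S.measurable_theta φ.2 fun α => (φ.1 α).measurable_fn,
    S.isEquivariant_theta hM fun α => (φ.1 α).isEquivariant_fn, by
      rw [(latticeSection g h).lintegral_eq (S.isEquivariant_theta hM fun α => (φ.1 α).isEquivariant_fn)
        (S.measurable_theta φ.2 fun α => (φ.1 α).measurable_fn), hc, lintegral_smul_measure,
        S.lintegral_theta hM.isSymm φ.2 (fun α => (φ.1 α).measurable_fn) fun α => (φ.1 α).isEquivariant_fn]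
      exact ENNReal.mul_lt_top ENNReal.coe_lt_top
        (ENNReal.sum_lt_top.2 fun α _ => lintegral_sec_lt_top hc0' hc' _)⟩
  map_add' φ ψ := Subtype.ext (funext fun x =>
    ((S.hasSum_theta φ.2 x).add (S.hasSum_theta ψ.2 x)).tsum_eq)
  map_smul' a φ := Subtype.ext (funext fun x => ((S.hasSum_theta φ.2 x).mul_left a).tsum_eq)

theorem thetaMap_fn (φ : boundedFunctions M n ν') :
    (S.thetaMap ν hM hc0' hc hc' φ).fn = S.theta fun α => (φ.1 α).fn := rfl

theorem norm_sq_thetaMap (φ : boundedFunctions M n ν') :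
    ‖S.thetaMap ν hM hc0' hc hc' φ‖ ^ 2 =
      c * (∑ α, ∫⁻ x, ‖(φ.1 α).fn ((polarizationSection g h).sec x)‖ₑ ^ 2).toReal := by
  rw [(latticeSection g h).norm_sq_eq, hc, lintegral_smul_measure, thetaMap_fn,
    S.lintegral_theta hM.isSymm φ.2 (fun α => (φ.1 α).measurable_fn) fun α => (φ.1 α).isEquivariant_fn]
  simp [ENNReal.smul_def]

/-- The functions `(λ, μ) ↦ 1_s(λ) e(N · μ)` are in the range of the theta map, being images of
indicator functions of subsets of a translate of the unit cube. -/
theorem exists_theta_eq_indicator (hM : M.IsSymm)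
    (hc' : ν'.map (polarizationSection g h).projQuot = c' • volume) (N : Fin h × Fin g → ℤ)
    {s : Set (UnitAddTorus (Fin h × Fin g))} (hs : MeasurableSet s) :
    ∃ φ : boundedFunctions M n ν', ∀ y,
      S.theta (fun α => (φ.1 α).fn) ((latticeSection g h).sec y) =
        s.indicator 1 y.1 * mFourier N y.2 := by
  classical
  set P := polarizationSection g h with hP
  let Q : Set (Fin h × Fin g → ℝ) := {x | (∀ i, (x - S.shift N) i ∈ Set.Ioc (0 : ℝ) 1) ∧
    torusMk (x - S.shift N) ∈ s}
  have hQ : MeasurableSet Q := by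
    have h1 : MeasurableSet {x : Fin h × Fin g → ℝ | ∀ i, x i ∈ Set.Ioc (0 : ℝ) 1} := by
      have : {x : Fin h × Fin g → ℝ | ∀ i, x i ∈ Set.Ioc (0 : ℝ) 1} =
          Set.univ.pi fun _ => Set.Ioc (0 : ℝ) 1 := by ext; simp
      rw [this]
      exact MeasurableSet.univ_pi fun _ => measurableSet_Ioc
    exact (h1.inter (measurable_torusMk hs)).preimage (measurable_sub_const (S.shift N))
  have hQb : ∀ x ∈ Q, ∀ p, x p ∈ Set.Icc (S.shift N p) (S.shift N p + 1) := by
    intro x hx p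
    have := hx.1 p
    rw [Pi.sub_apply] at this
    exact ⟨by linarith [this.1], by linarith [this.2]⟩
  let f : (Fin h × Fin g → ℝ) → ℂ := Q.indicator 1
  have hf : Measurable f := measurable_one.indicator hQ
  have hmem : P.extendFn (schrodingerChar M) f ∈
      inducedFunctions (polarizationSubgroup g h) (schrodingerChar M) ν' := by
    refine ⟨P.measurable_extendFn measurable_schrodingerChar hf, P.isEquivariant_extendFn _ f, ?_⟩
    rw [P.lintegral_eq (P.isEquivariant_extendFn _ f)
      (P.measurable_extendFn measurable_schrodingerChar hf), hc', lintegral_smul_measure]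
    refine ENNReal.mul_lt_top ENNReal.coe_lt_top ?_
    have h1 : ∀ x, ‖P.extendFn (schrodingerChar M) f (P.sec x)‖ₑ ^ 2 = Q.indicator 1 x := by
      intro x
      rw [P.extendFn_sec]
      by_cases hx : x ∈ Q
      · simp [f, Set.indicator_of_mem hx]
      · simp [f, Set.indicator_of_notMem hx]
    simp only [h1]
    rw [lintegral_indicator_one hQ]
    have hcomp : IsCompact (Set.univ.pi fun p => Set.Icc (S.shift N p) (S.shift N p + 1)) :=
      isCompact_univ_pi fun _ => isCompact_Icc
    have hsub : Q ⊆ Set.univ.pi fun p => Set.Icc (S.shift N p) (S.shift N p + 1) :=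
      fun x hx p _ => hQb x hx p
    exact (measure_mono hsub).trans_lt hcomp.measure_lt_top
  let φ : Fin n → PreInduced (polarizationSubgroup g h) (schrodingerChar M) ν' :=
    fun α => if α = S.cls N then ⟨_, hmem⟩ else 0
  have hφ : (φ (S.cls N)).fn = P.extendFn (schrodingerChar M) f := by
    have h1 : φ (S.cls N) = ⟨_, hmem⟩ := if_pos rfl
    rw [h1]
    rfl
  have hφ0 : ∀ α, α ≠ S.cls N → (φ α).fn = 0 := by
    intro α hα
    have h1 : φ α = 0 := if_neg hα
    rw [h1]
    rfl
  have hbd : HasBoundedSupport fun α => (φ α).fn := by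
    refine ⟨∑ p, (|S.shift N p| + 1), fun α x hx p => ?_⟩
    by_cases hα : α = S.cls N
    · subst hα
      simp only [hφ] at hx
      have hxQ : entries x.lam ∈ Q := by
        by_contra hxQ
        refine hx ?_
        rw [CosetSection.extendFn]
        refine mul_eq_zero_of_right _ ?_
        exact Set.indicator_of_notMem hxQ _
      have h1 := hQb _ hxQ p
      have h2 : |S.shift N p| + 1 ≤ ∑ p, (|S.shift N p| + 1) :=
        Finset.single_le_sum (f := fun p => |S.shift N p| + 1)
          (fun _ _ => by positivity) (Finset.mem_univ p)
      refine (abs_le.2 ⟨?_, ?_⟩).trans h2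
      · linarith [h1.1, neg_abs_le (S.shift N p)]
      · linarith [h1.2, le_abs_self (S.shift N p)]
    · exact (hx (congrFun (hφ0 α hα) x)).elim
  refine ⟨⟨φ, hbd⟩, fun y => ?_⟩
  rw [S.theta_sec_of_support hM N (fun α => (φ α).isEquivariant_fn) hφ0, hφ, P.extendFn_sec]
  · congr 1
    have h1 : S.shift N + torusRep y.1 ∈ Q ↔ y.1 ∈ s := by
      simp only [Q, Set.mem_ofPred_eq, add_sub_cancel_left, torusMk_torusRep]
      exact and_iff_right fun i => torusRep_mem_Ioc y.1 i
    by_cases hy : y.1 ∈ s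
    · rw [Set.indicator_of_mem hy]
      exact Set.indicator_of_mem (h1.2 hy) _
    · rw [Set.indicator_of_notMem hy]
      exact Set.indicator_of_notMem (fun h => hy (h1.1 h)) _
  · intro x hx i
    rw [hφ, P.extendFn_sec] at hx
    have := (Set.mem_of_indicator_ne_zero hx).1 i
    simpa using this

variable (ν) in
/-- The theta map as a map into the Hilbert space of the lattice representation. -/
def thetaMapMk (hM : IsHalfIntegral M) (hc0' : c' ≠ 0)
    (hc : ν.map (latticeSection g h).projQuot =
      c • (torusHaar (Fin h × Fin g)).prod (torusHaar (Fin h × Fin g)))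
    (hc' : ν'.map (polarizationSection g h).projQuot = c' • volume) : boundedFunctions M n ν' →ₗ[ℂ]
    InducedSpace (latticeSubgroup g h) (latticeChar M hM) ν :=
  (SeparationQuotient.mkCLM ℂ _).toLinearMap ∘ₗ S.thetaMap ν hM hc0' hc hc'

theorem thetaMapMk_apply (φ : boundedFunctions M n ν') :
    S.thetaMapMk ν hM hc0' hc hc' φ = SeparationQuotient.mk (S.thetaMap ν hM hc0' hc hc' φ) := rfl

/-- The range of the theta map is dense: all partial Fourier coefficients in `μ` of a function
orthogonal to it vanish. -/
theorem denseRange_thetaMapMk (hc0 : c ≠ 0) : DenseRange (S.thetaMapMk ν hM hc0' hc hc') := by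
  have hcomplete : CompleteSpace (PreInduced (latticeSubgroup g h) (latticeChar M hM) ν) :=
    (latticeSection g h).completeSpace (measurable_latticeChar hM)
  have hsub : Dense ((LinearMap.range (S.thetaMapMk ν hM hc0' hc hc') : Submodule ℂ _) :
      Set (InducedSpace (latticeSubgroup g h) (latticeChar M hM) ν)) := by
    rw [Submodule.dense_iff_topologicalClosure_eq_top, Submodule.topologicalClosure_eq_top_iff,
      Submodule.eq_bot_iff]
    intro w hw
    obtain ⟨F, rfl⟩ := SeparationQuotient.surjective_mk w
    set m := (torusHaar (Fin h × Fin g)).prod (torusHaar (Fin h × Fin g)) with hmdef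
    set F' := fun y => F.fn ((latticeSection g h).sec y) with hF'
    have hF'm : Measurable F' := F.measurable_fn.comp (latticeSection g h).measurable_sec
    have hcE : (c : ENNReal) ≠ 0 := by simpa using hc0
    have hmem : MemLp F' 2 m := by
      have h1 := (latticeSection g h).memLp F
      rw [hc] at h1
      have h2 := h1.smul_measure (c := (c : ENNReal)⁻¹) (ENNReal.inv_ne_top.2 hcE)
      have h3 : (c : ENNReal)⁻¹ • (c • m) = m := by
        have : c • m = (c : ENNReal) • m := rfl
        rw [this, smul_smul, ENNReal.inv_mul_cancel hcE ENNReal.coe_ne_top, one_smul]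
      rwa [h3] at h2
    have hzero : F' =ᵐ[m] 0 := by
      refine ae_eq_zero_of_partial_mFourierCoeff hmem hF'm fun s N hs => ?_
      obtain ⟨φ, hφ⟩ := S.exists_theta_eq_indicator (ν' := ν') hM.isSymm hc' N hs
      have h1 : inner ℂ (S.thetaMapMk ν hM hc0' hc hc' φ) (SeparationQuotient.mk F) = 0 :=
        hw _ ⟨φ, rfl⟩
      rw [thetaMapMk_apply, SeparationQuotient.inner_mk_mk, (latticeSection g h).inner_eq, hc,
        integral_smul_nnreal_measure, smul_eq_zero_iff_right hc0, thetaMap_fn] at h1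
      rw [← h1, ← integral_indicator (hs.prod MeasurableSet.univ)]
      refine integral_congr_ae (.of_forall fun y => ?_)
      simp only [hφ]
      by_cases hy : y.1 ∈ s
      · rw [Set.indicator_of_mem (by simpa using hy), Set.indicator_of_mem hy, Pi.one_apply,
          one_mul, mFourier_neg]
        rfl
      · rw [Set.indicator_of_notMem (by simpa using hy), Set.indicator_of_notMem hy, zero_mul,
          star_zero, zero_mul]
    have hn : ‖F‖ ^ 2 = 0 := by
      rw [(latticeSection g h).norm_sq_eq, hc, lintegral_smul_measure, lintegral_congr_ae
        (g := fun _ => 0) (hzero.mono fun y hy => by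
          have hy' : F.fn ((latticeSection g h).sec y) = 0 := hy
          simp [hy'])]
      simp
    rw [← norm_eq_zero, SeparationQuotient.norm_mk]
    simpa using hn
  exact hsub

end ThetaData

/-! ### Decomposition of the lattice representation -/

section Decomposition

open Heisenberg

variable {g h : ℕ} {M : Matrix (Fin h) (Fin h) ℝ}

/-- The theta map commutes with right translation. -/
theorem ThetaData.thetaMap_translate {n : ℕ} (S : ThetaData M g n) (hM : IsHalfIntegral M)
    {ν : Measure (Heisenberg g h ⧸ latticeSubgroup g h)} [ν.IsMulRightInvariant]
    {ν' : Measure (Heisenberg g h ⧸ polarizationSubgroup g h)} [ν'.IsMulRightInvariant]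
    {c c' : NNReal} (hc0' : c' ≠ 0)
    (hc : ν.map (latticeSection g h).projQuot =
      c • (torusHaar (Fin h × Fin g)).prod (torusHaar (Fin h × Fin g)))
    (hc' : ν'.map (polarizationSection g h).projQuot = c' • volume)
    (x : Heisenberg g h) (φ φ' : boundedFunctions M n ν')
    (hφ : ∀ α, φ'.1 α = preInducedTranslate _ _ _ x (φ.1 α)) :
    S.thetaMap ν hM hc0' hc hc' φ' =
      preInducedTranslate _ _ _ x (S.thetaMap ν hM hc0' hc hc' φ) := by
  refine Subtype.ext (funext fun y => tsum_congr fun N => ?_)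
  change (φ'.1 _).fn _ = (φ.1 _).fn _
  rw [hφ, preInducedTranslate_fn, mul_assoc]

/-- The lattice representation is equivalent to as many copies of the Schrödinger representation as
there are cosets of `2M ℤ^{h × g}` in `ℤ^{h × g}`. -/
theorem ThetaData.unitarilyEquivalentToCopies {n : ℕ} (S : ThetaData M g n)
    (hM : IsHalfIntegral M) (ν : Measure (Heisenberg g h ⧸ latticeSubgroup g h))
    [ν.IsHaarMeasure] (ν' : Measure (Heisenberg g h ⧸ polarizationSubgroup g h))
    [ν'.IsHaarMeasure] :
    UnitarilyEquivalentToCopies (inducedRep (latticeSubgroup g h) (latticeChar M hM) ν)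
      (inducedRep (polarizationSubgroup g h) (schrodingerChar M) ν') n := by
  obtain ⟨c, hc0, hc⟩ := exists_map_latticeSection ν
  obtain ⟨c', hc0', hc'⟩ := exists_map_polarizationSection ν'
  have : CompleteSpace (PreInduced (latticeSubgroup g h) (latticeChar M hM) ν) :=
    (latticeSection g h).completeSpace (measurable_latticeChar hM)
  have : CompleteSpace (PreInduced (polarizationSubgroup g h) (schrodingerChar M) ν') :=
    (polarizationSection g h).completeSpace measurable_schrodingerChar
  have hcpos : (0 : ℝ) < c := by positivity
  have hcpos' : (0 : ℝ) < c' := by positivity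
  -- This factor makes up for the normalizations of the two Haar measures.
  set a : ℂ := ((√(c' / c) : ℝ) : ℂ) with ha
  have hapos : 0 < √((c' : ℝ) / c) := by positivity
  have ha0 : a ≠ 0 := by
    rw [ha]; exact_mod_cast hapos.ne'
  have hanorm : ‖a‖ ^ 2 = c' / c := by
    rw [ha, Complex.norm_real, Real.norm_eq_abs, sq_abs, Real.sq_sqrt (by positivity)]
  refine unitarilyEquivalentToCopies_of_dense (a • S.thetaMapMk ν hM hc0' hc hc')
    (boundedFunctionsInclusion M n ν') ?_ denseRange_boundedFunctionsInclusion ?_ ?_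
  · refine (S.denseRange_thetaMapMk hM hc0' hc hc' hc0).mono ?_
    rintro _ ⟨φ, rfl⟩
    exact ⟨a⁻¹ • φ, by rw [LinearMap.smul_apply, map_smul, smul_smul, mul_inv_cancel₀ ha0, one_smul]⟩
  · intro φ
    rw [← sq_eq_sq₀ (norm_nonneg _) (norm_nonneg _), norm_sq_boundedFunctionsInclusion hc0' hc',
      LinearMap.smul_apply, norm_smul, mul_pow, hanorm, ThetaData.thetaMapMk_apply,
      SeparationQuotient.norm_mk, S.norm_sq_thetaMap hM hc0' hc hc', ← mul_assoc,
      div_mul_cancel₀ _ hcpos.ne']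
  · intro x φ
    let φ' : boundedFunctions M n ν' := ⟨fun α => preInducedTranslate _ _ _ x (φ.1 α),
      hasBoundedSupport_translate φ.2 x⟩
    refine ⟨φ', ?_, fun i => rfl⟩
    rw [LinearMap.smul_apply, LinearMap.smul_apply, map_smul, ThetaData.thetaMapMk_apply,
      S.thetaMap_translate hM hc0' hc hc' x φ φ' fun α => rfl]
    rfl

theorem IsHalfIntegral.exists_thetaData (hM : IsHalfIntegral M) (hpos : M.PosDef) (g : ℕ) :
    ∃ n : ℕ, (n : ℝ) = ((2 : ℝ) • M).det ^ g ∧ Nonempty (ThetaData M g n) := by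
  choose A hA using hM.two_mul
  have hA' : (2 : ℝ) • M = (Matrix.of A).map (Int.cast : ℤ → ℝ) := by
    ext i j; simpa using hA i j
  have hdet : ((2 : ℝ) • M).det = ((Matrix.of A).det : ℤ) := by
    rw [hA']
    exact ((Int.castRingHom ℝ).map_det (Matrix.of A)).symm
  have hdpos : 0 < ((2 : ℝ) • M).det := by
    rw [det_smul]
    have := hpos.det_pos
    positivity
  have hApos : 0 < (Matrix.of A).det := by
    rw [hdet] at hdpos
    exact_mod_cast hdpos
  have hunit : IsUnit ((2 : ℝ) • M).det := hdpos.ne'.isUnit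
  obtain ⟨r, hr⟩ := exists_coset_representatives g (Matrix.of A) hApos.ne'
  refine ⟨(Matrix.of A).det.natAbs ^ g, ?_, ⟨⟨Matrix.of A, ((2 : ℝ) • M)⁻¹, hA', ?_, ?_, r, hr⟩⟩⟩
  · rw [hdet, Nat.cast_pow, Nat.cast_natAbs, abs_of_pos hApos]
  · rw [← hA', mul_nonsing_inv _ hunit]
  · rw [← hA', nonsing_inv_mul _ hunit]

/-- If `(λ, μ, κ) ↦ e(tr Mκ)` is multiplicative on `Γ_L`, then `tr(M μ ᵗλ)` is an integer for all
integral `λ` and `μ`, and therefore this character coincides with `φ_M`. -/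
theorem eq_latticeChar (hM : IsHalfIntegral M) (χ : latticeSubgroup g h →* Circle)
    (hχ : ∀ x, χ x = Circle.exp (2 * Real.pi * (M * (x : Heisenberg g h).kappa).trace)) :
    χ = latticeChar M hM := by
  ext x
  congr 1
  have hzero : IsIntegralMatrix (0 : Matrix (Fin h) (Fin g) ℝ) := ⟨0, by simp⟩
  -- The product of `(-λ, 0, 0)` and `(0, μ, 0)` has `κ`-coordinate `-λ ᵗμ`.
  have hneg : IsIntegralMatrix (-x.1.lam) := by
    obtain ⟨a, ha⟩ := x.2.1
    exact ⟨-a, by ext i j; simp [ha]⟩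
  let y : latticeSubgroup g h := ⟨point (-x.1.lam) 0, hneg, hzero⟩
  let z : latticeSubgroup g h := ⟨point 0 x.1.mu, hzero, x.2.2⟩
  have h1 := χ.map_mul y z
  rw [hχ, hχ, hχ] at h1
  have hy : y.1.kappa = 0 := by simp [y, point]
  have hz : z.1.kappa = 0 := by simp [z, point]
  have hyz : (y * z : latticeSubgroup g h).1.kappa = -(x.1.lam * x.1.muᵀ) := by
    rw [Subgroup.coe_mul, kappa_mul, hy, hz]
    simp [y, z]
  rw [hyz, hy, hz] at h1
  have h2 : (M * (x.1.mu * x.1.lamᵀ)).trace = (M * (x.1.lam * x.1.muᵀ)).trace := by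
    rw [← trace_transpose, transpose_mul, transpose_mul, transpose_transpose, hM.isSymm.eq,
      trace_mul_comm]
  have h3 : latticeChar M hM x = Circle.exp (2 * Real.pi * (M * x.1.bracket).trace) := rfl
  rw [hχ, h3, bracket, Matrix.mul_add, trace_add, mul_add, Circle.exp_add, h2]
  have h4 : Circle.exp (2 * Real.pi * (M * (x.1.lam * x.1.muᵀ)).trace) = 1 := by
    have h5 : 2 * Real.pi * (M * (x.1.lam * x.1.muᵀ)).trace =
        -(2 * Real.pi * (M * -(x.1.lam * x.1.muᵀ)).trace) := by
      rw [Matrix.mul_neg, trace_neg]; ring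
    rw [h5, Circle.exp_neg, h1]
    simp
  rw [h4, mul_one]

end Decomposition

end

theorem mainTheorem1 (g h : ℕ) (hg : 0 < g) (hh : 0 < h)
    (M : Matrix (Fin h) (Fin h) ℝ) (hpos : M.PosDef) (hM : IsHalfIntegral M)
    (ν : Measure (Heisenberg g h ⧸ latticeSubgroup g h)) [ν.IsHaarMeasure]
    (ν' : Measure (Heisenberg g h ⧸ polarizationSubgroup g h)) [ν'.IsHaarMeasure] :
    ∃ n : ℕ, (n : ℝ) = ((2 : ℝ) • M).det ^ g ∧
      UnitarilyEquivalentToCopies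
        (inducedRep (latticeSubgroup g h) (latticeChar M hM) ν)
        (inducedRep (polarizationSubgroup g h) (schrodingerChar M) ν') n ∧
      ∀ χ : latticeSubgroup g h →* Circle,
        (∀ x, χ x = Circle.exp (2 * Real.pi * (M * (x : Heisenberg g h).kappa).trace)) →
        UnitarilyEquivalentToCopies
          (inducedRep (latticeSubgroup g h) χ ν)
          (inducedRep (polarizationSubgroup g h) (schrodingerChar M) ν') n := by
  obtain ⟨n, hn, ⟨S⟩⟩ := hM.exists_thetaData hpos g
  refine ⟨n, hn, S.unitarilyEquivalentToCopies hM ν ν', fun χ hχ => ?_⟩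
  rw [eq_latticeChar hM χ hχ]
  exact S.unitarilyEquivalentToCopies hM ν ν'
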